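/- **Local well-posedness of the Full-Coupled Cluster equations in a finite basis.** *Setting.* Let $1\le N\le K$ be integers and let $\phi_1,\dots,\phi_K\in H^1(\mathbb R^3;\mathbb C)$ be $L^2$-orthonormal. All inner products are antilinear in the first argument, and $H^1$ carries the full norm $\|u\|_{L^2}^2+\|\nabla u\|_{L^2}^2$. For an $N$-tuple $k$ of indices in $\{1,\dots,K\}$ let $\Psi_k:=\frac1{\sqrt{N!}}\det(\phi_{k_i}(x_j))_{i,j=1}^N$, and let $\mathcal V_K\subset H^1(\mathbb R^{3N};\mathbb C)$ be the span of the $\Psi_k$ with $k_1<\dots<k_N$, with the $H^1$ norm. Let $$H=-\tfrac12\sum_{j}\Delta_{x_j}-\sum_{j=1}^N\sum_{\alpha=1}^M\frac{Z_\alpha}{|X_\alpha-x_j|}+\sum_{i<j}\frac1{|x_i-x_j|},\qquad Z_\alpha>0,\ X_\alpha\in\mathbb R^3,$$ understood through its quadratic form $\langle u,Hv\rangle$ on $H^1(\mathbb R^{3N};\mathbb C)$. The Full-CI Hamiltonian $H_K$ is this form restricted to $\mathcal V_K$; an eigenfunction of $H_K$ with eigenvalue $\mathcal E\in\mathbb R$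 is a $0\ne\Psi\in\mathcal V_K$ with $\langle\Phi,H\Psi\rangle=\mathcal E(\Phi,\Psi)_{L^2}$ for all $\Phi\in\mathcal V_K$, and $\mathcal E$ is non-degenerate if its eigenspace is one-dimensional. Let $\Psi_0:=\Psi_{(1,\dots,N)}$. An excitation index $\mu\in\mathcal I^K$ consists of $i_1<\dots<i_j$ in $\{1,\dots,N\}$ and $\ell_1<\dots<\ell_j$ in $\{N+1,\dots,K\}$, $j\ge1$. The excitation operator $\mathcal X_\mu:\mathcal V_K\to\mathcal V_K$ is the linear map that replaces, in place, $\phi_{i_m}$ by $\phi_{\ell_m}$ in a determinant (and gives $0$ if some $\phi_{i_m}$ is absent or some $\phi_{\ell_m}$ is present); $\mathcal X_\mu^\dagger$ is defined in the same way with the roles of the $i_m$ and $\ell_m$ exchanged and is the $L^2$-adjoint of $\mathcal X_\mu$. Put $\Psi_\mu:=\mathcal X_\mu\Psi_0$ and $\widetilde{\mathcal V}_K:=\operatorname{span}\{\Psi_\mu:\mu\in\mathcal I^K\}$. Let $\mathbb V_K:=\mathbb C^{\mathcal I^K}$ with norm $\|\mathbf t\|_{\mathbb V_K}:=\|\sum_\mu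 \mathbf t_\mu\Psi_\mu\|_{H^1}$, and let $\mathbb V_K^*$ be its dual, paired by $\langle \mathbf s,\mathbf w\rangle=\sum_\mu\overline{\mathbf s_\mu}\mathbf w_\mu$, with the dual norm. For $\mathbf t\in\mathbb V_K$ let $\mathcal T:=\sum_\mu\mathbf t_\mu\mathcal X_\mu$ and $\mathcal T^\dagger:=\sum_\mu\overline{\mathbf t_\mu}\mathcal X_\mu^\dagger$. The restricted coupled cluster function $f_K:\mathbb V_K\to\mathbb V_K^*$ has the components $$f_K(\mathbf t)_\mu=\langle\Psi_\mu,e^{-\mathcal T}He^{\mathcal T}\Psi_0\rangle:=\langle e^{-\mathcal T^\dagger}\Psi_\mu,He^{\mathcal T}\Psi_0\rangle,\qquad\mu\in\mathcal I^K .$$ *Hypotheses.* Let $\mathbf t_K^*\in\mathbb V_K$ with cluster operator $\mathcal T_K^*$ be a zero of $f_K$ such that $\Psi_K^*:=e^{\mathcal T_K^*}\Psi_0$ is an intermediately normalised ($(\Psi_0,\Psi_K^*)_{L^2}=1$) eigenfunction of $H_K$ with non-degenerate eigenvalue $\mathcal E_K^*$. Let * $\gamma_K:=\inf_{0\ne w}\sup_{0\ne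 v}\frac{|\langle v,(H-\mathcal E_K^*)w\rangle|}{\|v\|_{H^1}\|w\|_{H^1}}$ over $v,w\in\mathcal V_K$ that are $L^2$-orthogonal to $\Psi_K^*$; * $\Theta_K:=\|e^{(\mathcal T_K^*)^\dagger}\|_{\mathcal V_K\to\mathcal V_K}\,\|\mathbb P_0^\perp e^{-\mathcal T_K^*}\|_{\mathcal V_K\to\mathcal V_K}$, where $\mathbb P_0^\perp=1-\mathbb P_0$ and $\mathbb P_0$ is the $L^2$-orthogonal projection onto $\operatorname{span}\{\Psi_0\}$; * $\alpha:=\sup\frac{|\langle\Phi,e^{-\mathcal T_K^*}(H-\mathcal E_K^*)e^{\mathcal T_K^*}\Psi\rangle|}{\|\Phi\|_{H^1}\|\Psi\|_{H^1}}$ over nonzero $\Phi,\Psi\in\widetilde{\mathcal V}_K$, where $e^{-\mathcal T_K^*}$ acts on functionals as the dual of $e^{-(\mathcal T_K^*)^\dagger}$; * $L(\delta):=\sup_{\mathbf s\in B_\delta(\mathbf t_K^*),\,\mathbf s\neq\mathbf t_K^*}\frac{\|Df_K(\mathbf t_K^*)-Df_K(\mathbf s)\|_{\mathbb V_K\to\mathbb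 V_K^*}}{\|\mathbf t_K^*-\mathbf s\|_{\mathbb V_K}}$ for $\delta>0$; * $R:=\sup_{\delta>0}\min\Big\{\delta,\ \frac{\gamma_K}{L(\delta)\Theta_K},\ \frac{2\alpha}{L(\delta)}\Big\}\in[0,\infty]$ (with $x/0=\infty$ for $x>0$ and $0/0=0$). *Conclusion.* If $K>N$, then $\gamma_K$, $\Theta_K$ and $\alpha$ are positive and finite, $L(\delta)<\infty$ for all $\delta>0$, and $R>0$. Moreover $f_K(B_R(\mathbf t_K^*))$ is an open subset of $\mathbb V_K^*$, the restriction of $f_K$ to the open ball $B_R(\mathbf t_K^*)$ is a (smooth) diffeomorphism onto its image, and for all $\mathbf s\in B_R(\mathbf t_K^*)$ $$\frac12\,\frac1{\alpha}\,\|f_K(\mathbf s)\|_{\mathbb V_K^*}\ \le\ \|\mathbf t_K^*-\mathbf s\|_{\mathbb V_K}\ \le\ 2\,\frac{\Theta_K}{\gamma_K}\,\|f_K(\mathbf s)\|_{\mathbb V_K^*}.$$ In particular, $\mathbf t_K^*$ is the only zero of $f_K$ in $B_R(\mathbf t_K^*)$. -/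

import Mathlib

open MeasureTheory ComplexConjugate
open scoped ENNReal ContDiff InnerProductSpace

noncomputable section

set_option linter.unusedSectionVars false

namespace CoupledCluster

section Sobolev
variable {X : Type*} [NormedAddCommGroup X] [NormedSpace ℝ X] [MeasureSpace X] [BorelSpace X]
  [IsFiniteMeasureOnCompacts (volume : Measure X)]
  {ι : Type*} [Fintype ι]

/-- Complex-valued square integrable functions. -/
abbrev L2 (X : Type*) [NormedAddCommGroup X] [MeasureSpace X] : Type _ :=
  Lp ℂ 2 (volume : Measure X)

/-- `g` is the weak derivative of `u` in the direction `b`. -/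
def IsWeakPartial (b : X) (u g : L2 X) : Prop :=
  ∀ η : X → ℝ, ContDiff ℝ ∞ η → HasCompactSupport η →
    ∫ x, fderiv ℝ η x b • u x = -∫ x, η x • g x

theorem test_integrable {η : X → ℝ} (h : Continuous η) (hc : HasCompactSupport η) {u : X → ℂ}
    (hu : MemLp u 2 (volume : Measure X)) : Integrable (fun x => η x • u x) :=
  memLp_one_iff_integrable.1 (hu.smul (h.memLp_of_hasCompactSupport hc (p := 2)))

theorem continuous_fderiv_test {η : X → ℝ} (h : ContDiff ℝ ∞ η) (b : X) :
    Continuous (fun x => fderiv ℝ η x b) :=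
  (h.continuous_fderiv (by simp)).clm_apply continuous_const

theorem IsWeakPartial.add {b : X} {u g u' g' : L2 X} (h : IsWeakPartial b u g)
    (h' : IsWeakPartial b u' g') : IsWeakPartial b (u + u') (g + g') := by
  intro η hη hc
  have hd := continuous_fderiv_test hη b
  have hdc : HasCompactSupport (fun x => fderiv ℝ η x b) := hc.fderiv_apply (𝕜 := ℝ) b
  have e1 : ∫ x, fderiv ℝ η x b • (u + u') x
      = ∫ x, (fderiv ℝ η x b • u x + fderiv ℝ η x b • u' x) := by
    refine integral_congr_ae ?_
    filter_upwards [Lp.coeFn_add u u'] with x hx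
    rw [hx, Pi.add_apply, smul_add]
  have e2 : ∫ x, η x • (g + g') x = ∫ x, (η x • g x + η x • g' x) := by
    refine integral_congr_ae ?_
    filter_upwards [Lp.coeFn_add g g'] with x hx
    rw [hx, Pi.add_apply, smul_add]
  rw [e1, e2, integral_add (test_integrable hd hdc (Lp.memLp u))
    (test_integrable hd hdc (Lp.memLp u')),
    integral_add (test_integrable hη.continuous hc (Lp.memLp g))
    (test_integrable hη.continuous hc (Lp.memLp g')), h η hη hc, h' η hη hc, neg_add]

theorem IsWeakPartial.smul {b : X} {u g : L2 X} (h : IsWeakPartial b u g) (c : ℂ) :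
    IsWeakPartial b (c • u) (c • g) := by
  intro η hη hc
  have e1 : ∫ x, fderiv ℝ η x b • (c • u) x = ∫ x, c • (fderiv ℝ η x b • u x) := by
    refine integral_congr_ae ?_
    filter_upwards [Lp.coeFn_smul c u] with x hx
    rw [hx, Pi.smul_apply, smul_comm]
  have e2 : ∫ x, η x • (c • g) x = ∫ x, c • (η x • g x) := by
    refine integral_congr_ae ?_
    filter_upwards [Lp.coeFn_smul c g] with x hx
    rw [hx, Pi.smul_apply, smul_comm]
  rw [e1, e2, integral_smul, integral_smul, h η hη hc, smul_neg]

theorem IsWeakPartial.zero (b : X) : IsWeakPartial b (0 : L2 X) 0 := by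
  intro η _ _
  have e (k : X → ℝ) : ∫ x, k x • (0 : L2 X) x = 0 := by
    refine integral_eq_zero_of_ae ?_
    filter_upwards [Lp.coeFn_zero ℂ 2 (volume : Measure X)] with x hx
    simp only [hx]
    exact smul_zero (k x)
  rw [e, e, neg_zero]

/-- Pairs consisting of an `L²` function and its weak partial derivatives along the `b i`, all in `L²`. -/
def sobolevSubmodule (b : ι → X) :
    Submodule ℂ (WithLp 2 (L2 X × PiLp 2 (fun _ : ι => L2 X))) where
  carrier := {p | ∀ i, IsWeakPartial (b i) p.fst (p.snd i)}
  add_mem' := fun h h' i => (h i).add (h' i)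
  zero_mem' := fun i => IsWeakPartial.zero (b i)
  smul_mem' := fun c _ h i => (h i).smul c

/-- The Sobolev space `H¹` of `L²` functions with weak partial derivatives in `L²` along the directions
`b i`. An element is stored together with its (unique) weak gradient, so that the inner product is
`(u, v) + ∑ i, (∂ᵢ u, ∂ᵢ v)`, antilinear in the first argument; see `SobolevH1.inner_def`. -/
def SobolevH1 (b : ι → X) : Type _ := sobolevSubmodule b

namespace SobolevH1
variable {b : ι → X}

instance : NormedAddCommGroup (SobolevH1 b) :=
  inferInstanceAs (NormedAddCommGroup (sobolevSubmodule b))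
instance : InnerProductSpace ℂ (SobolevH1 b) :=
  inferInstanceAs (InnerProductSpace ℂ (sobolevSubmodule b))

def toL2 : SobolevH1 b →ₗ[ℂ] L2 X where
  toFun u := u.1.fst
  map_add' _ _ := rfl
  map_smul' _ _ := rfl

def grad : SobolevH1 b →ₗ[ℂ] PiLp 2 (fun _ : ι => L2 X) where
  toFun u := u.1.snd
  map_add' _ _ := rfl
  map_smul' _ _ := rfl

def mk (u : L2 X) (g : ι → L2 X) (h : ∀ i, IsWeakPartial (b i) u (g i)) : SobolevH1 b :=
  ⟨WithLp.toLp 2 (u, WithLp.toLp 2 g), h⟩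

theorem isWeakPartial (u : SobolevH1 b) (i : ι) : IsWeakPartial (b i) (toL2 u) (grad u i) := u.2 i

theorem inner_def (u v : SobolevH1 b) :
    ⟪u, v⟫_ℂ = ⟪toL2 u, toL2 v⟫_ℂ + ∑ i, ⟪grad u i, grad v i⟫_ℂ := by
  refine (Submodule.coe_inner (sobolevSubmodule b) u v).trans ?_
  rw [WithLp.prod_inner_apply, PiLp.inner_apply]; rfl

end SobolevH1

end Sobolev

abbrev E3 : Type := EuclideanSpace ℝ (Fin 3)
/-- Configurations of `N` electrons, `(ℝ³)^N`, with Lebesgue (product) measure. -/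
abbrev Config (N : ℕ) : Type := Fin N → E3

def spDir (a : Fin 3) : E3 := EuclideanSpace.single a 1
/-- The coordinate directions of `(ℝ³)^N`. -/
def npDir (N : ℕ) (p : Fin N × Fin 3) : Config N := Pi.single p.1 (spDir p.2)

/-- `H¹(ℝ³; ℂ)`. -/
abbrev SingleH1 : Type := SobolevH1 spDir
/-- `H¹(ℝ^{3N}; ℂ)`. -/
abbrev ManyH1 (N : ℕ) : Type := SobolevH1 (npDir N)

theorem memLp_tensor {N : ℕ} (g : Fin N → L2 E3) :
    MemLp (fun x : Config N => ∏ j, g j (x j)) 2 volume := by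
  have hm : AEStronglyMeasurable (fun x : Config N => ∏ j, g j (x j)) volume := by
    refine (Finset.measurable_prod _ fun j _ => ?_).aestronglyMeasurable
    exact (Lp.stronglyMeasurable (g j)).measurable.comp (measurable_pi_apply j)
  rw [memLp_two_iff_integrable_sq_norm hm]
  simp only [norm_prod, ← Finset.prod_pow]
  exact Integrable.fintype_prod (f := fun j y => ‖g j y‖ ^ 2)
    fun j => (memLp_two_iff_integrable_sq_norm (Lp.memLp (g j)).1).1 (Lp.memLp (g j))

/-- The elementary tensor `g 1 ⊗ ⋯ ⊗ g N` in `L²(ℝ^{3N}; ℂ)`. -/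
def tensorL2 {N : ℕ} (g : Fin N → L2 E3) : L2 (Config N) := (memLp_tensor g).toLp _

theorem tensorL2_ae {N : ℕ} (g : Fin N → L2 E3) :
    tensorL2 g =ᵐ[volume] fun x => ∏ j, g j (x j) := MemLp.coeFn_toLp _

theorem isWeakPartial_tensor {N : ℕ} (g : Fin N → L2 E3) (j : Fin N) (h : L2 E3) (b : E3)
    (hw : IsWeakPartial b (g j) h) :
    IsWeakPartial (Pi.single j b : Config N) (tensorL2 g)
      (tensorL2 (Function.update g j h)) := by
  obtain _ | n := N
  · exact j.elim0
  intro η hη hc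
  have key (k : Config (n + 1) → ℝ) (hk : Continuous k) (hkc : HasCompactSupport k)
      (g' : Fin (n + 1) → L2 E3) :
      ∫ x, k x • tensorL2 g' x
        = ∫ y : Fin n → E3, (∫ x : E3, k (j.insertNth x y) • g' j x) *
            ∏ i, g' (j.succAbove i) (y i) := by
    have h1 : ∫ x, k x • tensorL2 g' x = ∫ x, k x • ∏ i, g' i (x i) := by
      refine integral_congr_ae ?_
      filter_upwards [tensorL2_ae g'] with x hx
      rw [hx]
    have hi := test_integrable hk hkc (memLp_tensor g')
    have mp := (volume_preserving_piFinSuccAbove (fun _ : Fin (n + 1) => E3) j).symm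
    have hi2 := (mp.integrable_comp_emb (MeasurableEquiv.measurableEmbedding _)).2 hi
    rw [h1, ← mp.integral_comp' (g := fun x => k x • ∏ i, g' i (x i)), Measure.volume_eq_prod]
    refine (integral_prod_symm _ hi2).trans ?_
    refine integral_congr_ae (Filter.Eventually.of_forall fun y => ?_)
    refine Eq.trans ?_ (integral_mul_const _ _)
    refine integral_congr_ae (Filter.Eventually.of_forall fun x => ?_)
    simp [MeasurableEquiv.piFinSuccAbove, Fin.insertNthEquiv, Fin.prod_univ_succAbove _ j, mul_assoc]
  rw [key _ (continuous_fderiv_test hη _) (hc.fderiv_apply (𝕜 := ℝ) _), key _ hη.continuous hc,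
    ← integral_neg]
  refine integral_congr_ae (Filter.Eventually.of_forall fun y => ?_)
  simp only [Function.update_self, ne_eq, Fin.succAbove_ne, not_false_eq_true,
    Function.update_of_ne]
  obtain ⟨z, hins⟩ : ∃ z : Config (n + 1), (fun x : E3 => (j.insertNth x y : Config (n + 1)))
      = fun x => z + ContinuousLinearMap.single ℝ (fun _ => E3) j x := by
    refine ⟨j.insertNth 0 y, ?_⟩
    funext x i
    refine Fin.succAboveCases j ?_ (fun i => ?_) i <;> simp
  have hsm : ContDiff ℝ ∞ fun x : E3 => (j.insertNth x y : Config (n + 1)) := by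
    rw [hins]
    fun_prop
  have hcl : Topology.IsClosedEmbedding fun x : E3 => (j.insertNth x y : Config (n + 1)) := by
    refine Function.LeftInverse.isClosedEmbedding (f := fun z : Config (n+1) => z j) ?_ ?_ ?_
    · intro x; simp
    · fun_prop
    · exact hsm.continuous
  have hd (x : E3) : fderiv ℝ (fun x : E3 => η (j.insertNth x y)) x b
      = fderiv ℝ η (j.insertNth x y) (Pi.single j b) := by
    have h2 : HasFDerivAt (fun x : E3 => (j.insertNth x y : Config (n + 1)))
        (ContinuousLinearMap.single ℝ (fun _ => E3) j) x := by
      rw [hins]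
      exact (ContinuousLinearMap.hasFDerivAt _).const_add _
    have h3 := ((hη.differentiable (by simp)) (j.insertNth x y)).hasFDerivAt.comp x h2
    have h4 := h3.fderiv
    simp only [Function.comp_def] at h4
    rw [h4]; simp
  have := hw (fun x => η (j.insertNth x y)) (hη.comp hsm) (hc.comp_isClosedEmbedding hcl)
  simp_rw [hd] at this
  rw [this]; ring

/-- The elementary tensor of `N` functions in `H¹(ℝ³)`, as an element of `H¹(ℝ^{3N})`. -/
def tensorH1 {N : ℕ} (g : Fin N → SingleH1) : ManyH1 N :=
  SobolevH1.mk (tensorL2 fun j => (g j).toL2)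
    (fun p => tensorL2 (Function.update (fun j => (g j).toL2) p.1 ((g p.1).grad p.2)))
    fun p => isWeakPartial_tensor _ p.1 _ _ ((g p.1).isWeakPartial p.2)

/-- `K` single-particle functions in `H¹(ℝ³; ℂ)` that are `L²`-orthonormal. -/
structure SingleParticleBasis (K : ℕ) where
  orb : Fin K → SingleH1
  orthonormal : Orthonormal ℂ fun k => SobolevH1.toL2 (orb k)

variable {N K : ℕ} (B : SingleParticleBasis K)

/-- The Slater determinant `(N!)^{-1/2} det (φ_{k i} (x_j))`, that is
`(N!)^{-1/2} ∑ π, sgn π ∏ i, φ_{k i} (x_{π i})`. -/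
def slater (k : Fin N → Fin K) : ManyH1 N :=
  ((Real.sqrt (Nat.factorial N) : ℝ) : ℂ)⁻¹ • ∑ π : Equiv.Perm (Fin N),
    ((Equiv.Perm.sign π : ℤ) : ℂ) • tensorH1 fun j => B.orb (k (π.symm j))

/-- The `L²` inner product, antilinear in the first argument. -/
def l2inner (u v : ManyH1 N) : ℂ := ⟪SobolevH1.toL2 u, SobolevH1.toL2 v⟫_ℂ

theorem inner_tensorL2 (g h : Fin N → L2 E3) :
    ⟪tensorL2 g, tensorL2 h⟫_ℂ = ∏ j, ⟪g j, h j⟫_ℂ := by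
  simp only [L2.inner_def]
  rw [← integral_fintype_prod_volume_eq_prod (fun j x => ⟪g j x, h j x⟫_ℂ)]
  refine integral_congr_ae ?_
  filter_upwards [tensorL2_ae g, tensorL2_ae h] with x h1 h2
  rw [h1, h2]
  simp [RCLike.inner_apply, Finset.prod_mul_distrib]

theorem inner_tensor_orb (a b : Fin N → Fin K) :
    l2inner (tensorH1 fun j => B.orb (a j)) (tensorH1 fun j => B.orb (b j))
      = if a = b then 1 else 0 := by
  have h := orthonormal_iff_ite.1 B.orthonormal
  refine (inner_tensorL2 _ _).trans ?_
  simp only [h]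
  split_ifs with hab
  · simp [hab]
  · obtain ⟨j, hj⟩ := Function.ne_iff.1 hab
    exact Finset.prod_eq_zero (Finset.mem_univ j) (if_neg hj)

theorem inner_slater (k l : Fin N → Fin K) :
    l2inner (slater B k) (slater B l) = (Nat.factorial N : ℂ)⁻¹ *
      ∑ π : Equiv.Perm (Fin N), ∑ ρ : Equiv.Perm (Fin N),
        ((Equiv.Perm.sign π : ℤ) : ℂ) * ((Equiv.Perm.sign ρ : ℤ) : ℂ) *
          if k ∘ π.symm = l ∘ ρ.symm then 1 else 0 := by
  have hs : ((Real.sqrt (Nat.factorial N) : ℝ) : ℂ)⁻¹ * ((Real.sqrt (Nat.factorial N) : ℝ) : ℂ)⁻¹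
      = (Nat.factorial N : ℂ)⁻¹ := by
    rw [← mul_inv, ← Complex.ofReal_mul, Real.mul_self_sqrt (by positivity)]
    simp
  have key (π ρ : Equiv.Perm (Fin N)) := inner_tensor_orb B (k ∘ π.symm) (l ∘ ρ.symm)
  simp only [l2inner, Function.comp_apply] at key
  simp only [l2inner, slater, map_smul, map_sum, inner_smul_left, inner_smul_right, sum_inner,
    inner_sum, key, map_inv₀, Complex.conj_ofReal, map_intCast]
  rw [← hs, Finset.sum_comm]
  simp only [Finset.mul_sum]
  refine Finset.sum_congr rfl fun π _ => Finset.sum_congr rfl fun ρ _ => ?_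
  ring

theorem orthonormal_slater {ι : Type*} (κ : ι → Fin N → Fin K)
    (hinj : ∀ i, Function.Injective (κ i)) (hr : Function.Injective fun i => Set.range (κ i)) :
    Orthonormal ℂ fun i => SobolevH1.toL2 (slater B (κ i)) := by
  classical
  rw [orthonormal_iff_ite]
  intro i i'
  refine (inner_slater B (κ i) (κ i')).trans ?_
  split_ifs with hii
  · subst hii
    have h1 (π ρ : Equiv.Perm (Fin N)) : (κ i ∘ π.symm = κ i ∘ ρ.symm) ↔ ρ = π := by
      constructor
      · intro h
        have h2 : π.symm = ρ.symm := Equiv.ext fun j => hinj i (congrFun h j)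
        exact (Equiv.symm_bijective.injective h2).symm
      · rintro rfl; rfl
    have h2 (π : Equiv.Perm (Fin N)) :
        ((Equiv.Perm.sign π : ℤ) : ℂ) * ((Equiv.Perm.sign π : ℤ) : ℂ) = 1 := by
      rw [← Int.cast_mul, ← Units.val_mul, Int.units_mul_self]; simp
    simp only [h1, mul_ite, mul_one, mul_zero, Finset.sum_ite_eq', Finset.mem_univ, if_true, h2,
      Finset.sum_const, Finset.card_univ, Fintype.card_perm, Fintype.card_fin, nsmul_eq_mul]
    exact inv_mul_cancel₀ (by exact_mod_cast Nat.factorial_ne_zero N)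
  · have h1 (π ρ : Equiv.Perm (Fin N)) : ¬ (κ i ∘ π.symm = κ i' ∘ ρ.symm) := by
      intro h
      refine hii (hr ?_)
      have := congrArg Set.range h
      simpa [Set.range_comp] using this
    simp [h1]

theorem slater_perm (k : Fin N → Fin K) (σ : Equiv.Perm (Fin N)) :
    slater B (k ∘ σ) = ((Equiv.Perm.sign σ : ℤ) : ℂ) • slater B k := by
  rw [slater, slater, smul_comm]
  congr 1
  rw [Finset.smul_sum]
  refine Fintype.sum_equiv (Equiv.mulRight σ⁻¹) _ _ fun π => ?_
  have h2 : ((Equiv.Perm.sign σ : ℤ) : ℂ) * ((Equiv.Perm.sign σ : ℤ) : ℂ) = 1 := by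
    rw [← Int.cast_mul, ← Units.val_mul, Int.units_mul_self]; simp
  rw [smul_smul]
  congr 1
  · simp only [Equiv.coe_mulRight, map_mul, map_inv, Units.val_mul, Int.cast_mul,
      Int.units_inv_eq_self]
    linear_combination -((Equiv.Perm.sign π : ℤ) : ℂ) * h2

/-- Strictly increasing `N`-tuples of orbital indices. -/
abbrev OrderedIndex (N K : ℕ) : Type := {k : Fin N → Fin K // StrictMono k}

/-- The span of the Slater determinants of strictly increasing index tuples. -/
def fciSubmodule (N : ℕ) (B : SingleParticleBasis K) : Submodule ℂ (ManyH1 N) :=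
  Submodule.span ℂ (Set.range fun k : OrderedIndex N K => slater B k.1)

theorem slater_mem (k : Fin N → Fin K) : slater B k ∈ fciSubmodule N B := by
  by_cases hk : Function.Injective k
  · have hm : StrictMono (k ∘ Tuple.sort k) :=
      (Tuple.monotone_sort k).strictMono_of_injective (hk.comp (Tuple.sort k).injective)
    have h : slater B (k ∘ Tuple.sort k) ∈ fciSubmodule N B :=
      Submodule.subset_span ⟨⟨_, hm⟩, rfl⟩
    rw [slater_perm] at h
    have h2 := Submodule.smul_mem _ (((Equiv.Perm.sign (Tuple.sort k) : ℤ) : ℂ)) h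
    rwa [smul_smul, ← Int.cast_mul, ← Units.val_mul, Int.units_mul_self, Units.val_one,
      Int.cast_one, one_smul] at h2
  · have hz : slater B k = 0 := by
      simp only [Function.Injective, not_forall] at hk
      obtain ⟨i, j, hij, hne⟩ := hk
      have h := slater_perm B k (Equiv.swap i j)
      have hc : k ∘ Equiv.swap i j = k := by
        funext m
        simp only [Function.comp_apply, Equiv.swap_apply_def]
        split_ifs with h1 h2
        · rw [h1, hij]
        · rw [h2, hij]
        · rfl
      rw [hc, Equiv.Perm.sign_swap hne] at h
      have h2 : (2 : ℂ) • slater B k = 0 := by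
        rw [two_smul]
        nth_rewrite 1 [h]
        simp
      simpa using h2
    rw [hz]; exact Submodule.zero_mem _

/-- The `N`-particle approximation space: the span of the Slater determinants of strictly increasing
tuples, with the `H¹` inner product. -/
def FCISpace (N : ℕ) (B : SingleParticleBasis K) : Type := fciSubmodule N B

namespace FCISpace
variable {B}

instance : NormedAddCommGroup (FCISpace N B) :=
  inferInstanceAs (NormedAddCommGroup (fciSubmodule N B))
instance : InnerProductSpace ℂ (FCISpace N B) :=
  inferInstanceAs (InnerProductSpace ℂ (fciSubmodule N B))

def toH1 : FCISpace N B →ₗ[ℂ] ManyH1 N where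
  toFun u := u.1
  map_add' _ _ := rfl
  map_smul' _ _ := rfl

/-- The Slater determinant of an arbitrary index tuple, as an element of the approximation space. -/
def det (B : SingleParticleBasis K) (k : Fin N → Fin K) : FCISpace N B := ⟨slater B k, slater_mem B k⟩

theorem toH1_det (k : Fin N → Fin K) : toH1 (det B k) = slater B k := rfl

theorem linearIndependent_slater (B : SingleParticleBasis K) :
    LinearIndependent ℂ fun k : OrderedIndex N K => slater B k.1 := by
  refine LinearIndependent.of_comp SobolevH1.toL2 ?_
  refine (orthonormal_slater B (fun k : OrderedIndex N K => k.1) (fun k => k.2.injective)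
    ?_).linearIndependent
  intro k l h
  exact Subtype.ext ((StrictMono.range_inj k.2 l.2).1 h)

/-- The basis of Slater determinants of strictly increasing tuples. -/
def basis (N : ℕ) (B : SingleParticleBasis K) :
    Module.Basis (OrderedIndex N K) ℂ (FCISpace N B) :=
  Module.Basis.span (linearIndependent_slater B)

theorem basis_apply (k : OrderedIndex N K) : basis N B k = det B k.1 :=
  Module.Basis.span_apply (linearIndependent_slater B) k

instance : FiniteDimensional ℂ (FCISpace N B) := (basis N B).finiteDimensional_of_finite

end FCISpace

/-- Nuclei with positive charges at fixed positions. -/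
structure Molecule where
  numNuclei : ℕ
  charge : Fin numNuclei → ℝ
  charge_pos : ∀ α, 0 < charge α
  pos : Fin numNuclei → E3

/-- Electron-nucleus attraction and electron-electron repulsion. -/
def Molecule.potential (mol : Molecule) (x : Config N) : ℝ :=
  (∑ j, ∑ α, -mol.charge α / ‖mol.pos α - x j‖) + ∑ j, ∑ i ∈ Finset.Iio j, 1 / ‖x i - x j‖

/-- `⟨u, H v⟩` for the electronic Hamiltonian `H = -½ Δ + V`, as a form on `H¹`. -/
def Molecule.energyForm (mol : Molecule) (u v : ManyH1 N) : ℂ :=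
  (1 / 2) * ∑ p, ⟪SobolevH1.grad u p, SobolevH1.grad v p⟫_ℂ +
    ∫ x, (mol.potential x : ℂ) * (conj (SobolevH1.toL2 u x) * SobolevH1.toL2 v x)

/-- Excitation indices: a nonempty set of occupied orbitals (the first `N` ones) and a set of virtual
orbitals (the remaining ones) of the same cardinality, each listed in increasing order. -/
def ExcIndex (N K : ℕ) : Type :=
  {p : Finset (Fin K) × Finset (Fin K) // (∀ i ∈ p.1, (i : ℕ) < N) ∧ (∀ l ∈ p.2, N ≤ (l : ℕ)) ∧
    p.1.Nonempty ∧ p.1.card = p.2.card}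

instance : Fintype (ExcIndex N K) := inferInstanceAs (Fintype {p : Finset (Fin K) × Finset (Fin K) //
  (∀ i ∈ p.1, (i : ℕ) < N) ∧ (∀ l ∈ p.2, N ≤ (l : ℕ)) ∧ p.1.Nonempty ∧ p.1.card = p.2.card})

def ExcIndex.occ (μ : ExcIndex N K) : Finset (Fin K) := μ.1.1
def ExcIndex.vir (μ : ExcIndex N K) : Finset (Fin K) := μ.1.2
theorem ExcIndex.card_eq (μ : ExcIndex N K) : μ.occ.card = μ.vir.card := μ.2.2.2.2

/-- Replace the `m`-th smallest element of `I` by the `m`-th smallest element of `L`. -/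
def replaceIndex (I L : Finset (Fin K)) (h : I.card = L.card) (p : Fin K) : Fin K :=
  if hp : p ∈ I then L.orderIsoOfFin h.symm ((I.orderIsoOfFin rfl).symm ⟨p, hp⟩) else p

open scoped Classical in
/-- The linear map that sends a Slater determinant to the determinant in which the orbitals of `I` are
replaced, in place, by those of `L`, or to `0` if an orbital of `I` does not occur in it or one of `L`
does. -/
def substitutionOp (N : ℕ) (B : SingleParticleBasis K) (I L : Finset (Fin K))
    (h : I.card = L.card) : FCISpace N B →ₗ[ℂ] FCISpace N B :=
  (FCISpace.basis N B).constr ℂ fun ν =>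
    if (∀ i ∈ I, i ∈ Set.range ν.1) ∧ ∀ l ∈ L, l ∉ Set.range ν.1 then
      FCISpace.det B (replaceIndex I L h ∘ ν.1)
    else 0

/-- The excitation operator `X_μ` on the approximation space. -/
def excitationOp (B : SingleParticleBasis K) (μ : ExcIndex N K) :
    FCISpace N B →ₗ[ℂ] FCISpace N B :=
  substitutionOp N B μ.occ μ.vir μ.card_eq

/-- The de-excitation operator `X_μ†` on the approximation space. -/
def deexcitationOp (B : SingleParticleBasis K) (μ : ExcIndex N K) :
    FCISpace N B →ₗ[ℂ] FCISpace N B :=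
  substitutionOp N B μ.vir μ.occ μ.card_eq.symm

/-- The reference determinant `Ψ₀`, built from the first `N` orbitals. -/
def refDet (B : SingleParticleBasis K) (h : N ≤ K) : FCISpace N B :=
  FCISpace.det B (Fin.castLE h)

/-- The excited determinant `Ψ_μ = X_μ Ψ₀`. -/
def excDet (B : SingleParticleBasis K) (h : N ≤ K) (μ : ExcIndex N K) : FCISpace N B :=
  excitationOp B μ (refDet B h)

theorem replaceIndex_mem {I L : Finset (Fin K)} (h : I.card = L.card) {p : Fin K} (hp : p ∈ I) :
    replaceIndex I L h p ∈ L := by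
  rw [replaceIndex, dif_pos hp]; exact Subtype.mem _

theorem replaceIndex_of_notMem {I L : Finset (Fin K)} (h : I.card = L.card) {p : Fin K}
    (hp : p ∉ I) : replaceIndex I L h p = p := dif_neg hp

theorem ExcIndex.mem_occ_iff (μ : ExcIndex N K) (h : N ≤ K) (p : Fin N) :
    Fin.castLE h p ∈ μ.occ ↔
      N ≤ (replaceIndex μ.occ μ.vir μ.card_eq (Fin.castLE h p) : ℕ) := by
  constructor
  · intro hp
    exact μ.2.2.1 _ (replaceIndex_mem μ.card_eq hp)
  · intro hp
    by_contra hc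
    rw [replaceIndex_of_notMem μ.card_eq hc] at hp
    exact absurd p.2 (not_lt.2 hp)

theorem ExcIndex.tuple_injective (μ : ExcIndex N K) (h : N ≤ K) :
    Function.Injective (replaceIndex μ.occ μ.vir μ.card_eq ∘ Fin.castLE h) := by
  intro p q hpq
  simp only [Function.comp_apply] at hpq
  by_cases hp : Fin.castLE h p ∈ μ.occ
  · have hq : Fin.castLE h q ∈ μ.occ := by
      rw [μ.mem_occ_iff h, ← hpq, ← μ.mem_occ_iff h]; exact hp
    rw [replaceIndex, dif_pos hp, replaceIndex, dif_pos hq] at hpq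
    have h1 := (μ.occ.orderIsoOfFin rfl).symm.injective
      ((μ.vir.orderIsoOfFin μ.card_eq.symm).injective (Subtype.ext hpq))
    exact Fin.castLE_injective h (congrArg Subtype.val h1)
  · have hq : Fin.castLE h q ∉ μ.occ := by
      rw [μ.mem_occ_iff h, ← hpq, ← μ.mem_occ_iff h]; exact hp
    rw [replaceIndex_of_notMem _ hp, replaceIndex_of_notMem _ hq] at hpq
    exact Fin.castLE_injective h hpq

theorem ExcIndex.exists_of_mem_occ (μ : ExcIndex N K) (h : N ≤ K) {i : Fin K} (hi : i ∈ μ.occ) :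
    ∃ p : Fin N, Fin.castLE h p = i := ⟨⟨i, μ.2.1 i hi⟩, rfl⟩

theorem ExcIndex.vir_eq (μ : ExcIndex N K) (h : N ≤ K) (l : Fin K) :
    l ∈ μ.vir ↔ N ≤ (l : ℕ) ∧
      l ∈ Set.range (replaceIndex μ.occ μ.vir μ.card_eq ∘ Fin.castLE h) := by
  constructor
  · intro hl
    refine ⟨μ.2.2.1 l hl, ?_⟩
    set m := (μ.vir.orderIsoOfFin μ.card_eq.symm).symm ⟨l, hl⟩ with hm
    obtain ⟨p, hp⟩ := μ.exists_of_mem_occ h (μ.occ.orderIsoOfFin rfl m).2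
    refine ⟨p, ?_⟩
    have hmem : Fin.castLE h p ∈ μ.occ := hp ▸ (μ.occ.orderIsoOfFin rfl m).2
    rw [Function.comp_apply, replaceIndex, dif_pos hmem]
    have : (⟨Fin.castLE h p, hmem⟩ : {x // x ∈ μ.occ}) = μ.occ.orderIsoOfFin rfl m :=
      Subtype.ext hp
    rw [this, OrderIso.symm_apply_apply, hm, OrderIso.apply_symm_apply]
  · rintro ⟨hl, p, rfl⟩
    exact replaceIndex_mem μ.card_eq ((μ.mem_occ_iff h p).2 hl)

theorem ExcIndex.occ_eq (μ : ExcIndex N K) (h : N ≤ K) (i : Fin K) :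
    i ∈ μ.occ ↔ (i : ℕ) < N ∧
      i ∉ Set.range (replaceIndex μ.occ μ.vir μ.card_eq ∘ Fin.castLE h) := by
  constructor
  · intro hi
    refine ⟨μ.2.1 i hi, ?_⟩
    rintro ⟨p, hp⟩
    rw [Function.comp_apply] at hp
    by_cases hpo : Fin.castLE h p ∈ μ.occ
    · have h1 := (μ.mem_occ_iff h p).1 hpo
      rw [hp] at h1
      exact absurd (μ.2.1 i hi) (not_lt.2 h1)
    · rw [replaceIndex_of_notMem _ hpo] at hp
      exact hpo (hp ▸ hi)
  · rintro ⟨hi, hn⟩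
    by_contra hc
    exact hn ⟨⟨i, hi⟩, replaceIndex_of_notMem μ.card_eq hc⟩

theorem ExcIndex.range_injective (h : N ≤ K) : Function.Injective fun μ : ExcIndex N K =>
    Set.range (replaceIndex μ.occ μ.vir μ.card_eq ∘ Fin.castLE h) := by
  intro μ μ' hr
  simp only at hr
  refine Subtype.ext (Prod.ext (Finset.ext fun i => ?_) (Finset.ext fun l => ?_))
  · exact ((μ.occ_eq h i).trans (by rw [hr])).trans (μ'.occ_eq h i).symm
  · exact ((μ.vir_eq h l).trans (by rw [hr])).trans (μ'.vir_eq h l).symm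

open scoped Classical in
theorem substitutionOp_det (I L : Finset (Fin K)) (h : I.card = L.card) (ν : Fin N → Fin K)
    (hν : StrictMono ν) : substitutionOp N B I L h (FCISpace.det B ν) =
      if (∀ i ∈ I, i ∈ Set.range ν) ∧ ∀ l ∈ L, l ∉ Set.range ν then
        FCISpace.det B (replaceIndex I L h ∘ ν) else 0 := by
  rw [← FCISpace.basis_apply ⟨ν, hν⟩]
  exact Module.Basis.constr_basis _ _ _ _

theorem excDet_eq (h : N ≤ K) (μ : ExcIndex N K) :
    excDet B h μ = FCISpace.det B (replaceIndex μ.occ μ.vir μ.card_eq ∘ Fin.castLE h) := by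
  refine (substitutionOp_det B μ.occ μ.vir μ.card_eq (Fin.castLE h)
    (Fin.strictMono_castLE h)).trans (if_pos ⟨fun i hi => ?_, fun l hl => ?_⟩)
  · exact μ.exists_of_mem_occ h hi
  · rintro ⟨p, rfl⟩
    exact absurd p.2 (not_lt.2 (μ.2.2.1 _ hl))

theorem linearIndependent_excDet (h : N ≤ K) : LinearIndependent ℂ (excDet B h) := by
  refine LinearIndependent.of_comp FCISpace.toH1 (LinearIndependent.of_comp SobolevH1.toL2 ?_)
  have := (orthonormal_slater B _ (fun μ : ExcIndex N K => μ.tuple_injective h)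
    (ExcIndex.range_injective h)).linearIndependent
  have e : (SobolevH1.toL2 ∘ FCISpace.toH1 ∘ excDet B h) = fun μ : ExcIndex N K =>
      SobolevH1.toL2 (slater B (replaceIndex μ.occ μ.vir μ.card_eq ∘ Fin.castLE h)) := by
    funext μ
    simp only [Function.comp_apply, excDet_eq, FCISpace.toH1_det]
  rw [e]; exact this

/-- Coefficient vectors indexed by the excitation indices, with the norm `‖t‖ = ‖∑ μ, t_μ Ψ_μ‖_{H¹}`. -/
def CoeffSpace (_B : SingleParticleBasis K) (_h : N ≤ K) : Type := ExcIndex N K → ℂ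

namespace CoeffSpace
variable {B} {h : N ≤ K}

instance : AddCommGroup (CoeffSpace B h) := inferInstanceAs (AddCommGroup (ExcIndex N K → ℂ))
instance : Module ℂ (CoeffSpace B h) := inferInstanceAs (Module ℂ (ExcIndex N K → ℂ))
instance : FiniteDimensional ℂ (CoeffSpace B h) :=
  inferInstanceAs (FiniteDimensional ℂ (ExcIndex N K → ℂ))

def coord (μ : ExcIndex N K) : CoeffSpace B h →ₗ[ℂ] ℂ :=
  LinearMap.proj (R := ℂ) (φ := fun _ : ExcIndex N K => ℂ) μ

/-- `t ↦ ∑ μ, t_μ Ψ_μ`. -/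
def expand : CoeffSpace B h →ₗ[ℂ] FCISpace N B := ∑ μ, (coord μ).smulRight (excDet B h μ)

theorem expand_apply (t : CoeffSpace B h) : expand t = ∑ μ, coord μ t • excDet B h μ := by
  simp [expand]

theorem expand_injective : Function.Injective (expand : CoeffSpace B h →ₗ[ℂ] FCISpace N B) := by
  rw [injective_iff_map_eq_zero]
  intro t ht
  rw [expand_apply] at ht
  have := Fintype.linearIndependent_iff.1 (linearIndependent_excDet B h) _ ht
  exact funext this

instance : NormedAddCommGroup (CoeffSpace B h) :=
  NormedAddCommGroup.induced _ (FCISpace N B) expand expand_injective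

instance : NormedSpace ℂ (CoeffSpace B h) where
  norm_smul_le c t := by
    change ‖expand (c • t)‖ ≤ ‖c‖ * ‖expand t‖
    rw [map_smul, norm_smul]

theorem norm_def (t : CoeffSpace B h) : ‖t‖ = ‖expand t‖ := rfl

end CoeffSpace

/-- The dual of the coefficient space with its operator norm. The inner products are antilinear in the
first argument, so the pairing `⟨s, F⟩` is antilinear in `s`. -/
abbrev AntiDual (B : SingleParticleBasis K) (h : N ≤ K) : Type := CoeffSpace B h →L⋆[ℂ] ℂ

variable {B} {h : N ≤ K}

/-- The cluster operator `T = ∑ μ, t_μ X_μ`. -/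
def clusterOp (t : CoeffSpace B h) : FCISpace N B →L[ℂ] FCISpace N B :=
  ∑ μ, CoeffSpace.coord μ t • LinearMap.toContinuousLinearMap (excitationOp B μ)

/-- The `L²`-adjoint `T† = ∑ μ, conj t_μ X_μ†`. -/
def clusterAdj (t : CoeffSpace B h) : FCISpace N B →L[ℂ] FCISpace N B :=
  ∑ μ, conj (CoeffSpace.coord μ t) • LinearMap.toContinuousLinearMap (deexcitationOp B μ)

/-- `⟨u, e^{-T} H e^{T} v⟩`, where `e^{-T}` acts on functionals as the dual of `e^{-T†}`. -/
def ccForm (mol : Molecule) (t : CoeffSpace B h) (u v : FCISpace N B) : ℂ :=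
  mol.energyForm (NormedSpace.exp (-clusterAdj t) u).toH1 (NormedSpace.exp (clusterOp t) v).toH1

/-- The component `⟨X_μ Ψ₀, e^{-T} H e^{T} Ψ₀⟩`. -/
def ccComponent (mol : Molecule) (μ : ExcIndex N K) (t : CoeffSpace B h) : ℂ :=
  ccForm mol t (excDet B h μ) (refDet B h)

/-- The restricted coupled cluster function; see `ccFunction_apply`. -/
def ccFunction (mol : Molecule) (t : CoeffSpace B h) : AntiDual B h :=
  ∑ μ, ccComponent mol μ t • ((starL ℂ : ℂ ≃L⋆[ℂ] ℂ) : ℂ →L⋆[ℂ] ℂ).comp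
    (LinearMap.toContinuousLinearMap (CoeffSpace.coord μ))

theorem ccFunction_apply (mol : Molecule) (t s : CoeffSpace B h) :
    ccFunction mol t s = ∑ μ, conj (CoeffSpace.coord μ s) * ccComponent mol μ t := by
  simp [ccFunction, mul_comm]

/-- The `L²` inner product on the approximation space. -/
def overlap (u v : FCISpace N B) : ℂ := l2inner u.toH1 v.toH1

/-- `⟨u, (H - E) v⟩`. -/
def shiftedForm (mol : Molecule) (E : ℝ) (u v : FCISpace N B) : ℂ :=
  mol.energyForm u.toH1 v.toH1 - E * overlap u v

/-- `Ψ` is an eigenfunction of the Full-CI Hamiltonian with eigenvalue `E`. -/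
def IsEigenfunction (mol : Molecule) (E : ℝ) (Ψ : FCISpace N B) : Prop :=
  Ψ ≠ 0 ∧ ∀ Φ : FCISpace N B, mol.energyForm Φ.toH1 Ψ.toH1 = E * overlap Φ Ψ

/-- The eigenspace of the eigenvalue `E` is spanned by any one of its eigenfunctions. -/
def IsNondegenerate (mol : Molecule) (B : SingleParticleBasis K) (N : ℕ) (E : ℝ) : Prop :=
  ∀ Ψ Ψ' : FCISpace N B, IsEigenfunction mol E Ψ → IsEigenfunction mol E Ψ' → ∃ c : ℂ, Ψ' = c • Ψ

/-- `P₀^⊥ = 1 - P₀` with `P₀` the `L²`-orthogonal projection onto the span of `Ψ₀`. -/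
def projPerp (B : SingleParticleBasis K) (h : N ≤ K) : FCISpace N B →L[ℂ] FCISpace N B :=
  LinearMap.toContinuousLinearMap
    { toFun := fun Φ => Φ - overlap (refDet B h) Φ • refDet B h
      map_add' := fun Φ Φ' => by
        simp only [overlap, l2inner, map_add, inner_add_right, add_smul]
        abel
      map_smul' := fun c Φ => by
        simp only [overlap, l2inner, map_smul, inner_smul_right, RingHom.id_apply, smul_sub,
          mul_smul] }

/-- The inf-sup constant `γ` of `H - E` on the `L²`-orthogonal complement of `Ψ`. -/
def infSupConst (mol : Molecule) (E : ℝ) (Ψ : FCISpace N B) : ℝ≥0∞ :=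
  ⨅ (w : FCISpace N B) (_ : overlap Ψ w = 0 ∧ w ≠ 0),
    ⨆ (v : FCISpace N B) (_ : overlap Ψ v = 0 ∧ v ≠ 0),
      ‖shiftedForm mol E v w‖ₑ / (‖v‖ₑ * ‖w‖ₑ)

/-- `Θ = ‖e^{T†}‖ ‖P₀^⊥ e^{-T}‖`, with operator norms for the `H¹` norm. -/
def thetaConst (t : CoeffSpace B h) : ℝ≥0∞ :=
  ‖NormedSpace.exp (clusterAdj t)‖ₑ * ‖(projPerp B h).comp (NormedSpace.exp (-clusterOp t))‖ₑ

/-- The span of the excited determinants. -/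
def excitedSubspace (B : SingleParticleBasis K) (h : N ≤ K) : Submodule ℂ (FCISpace N B) :=
  Submodule.span ℂ (Set.range (excDet B h))

/-- The continuity constant `α`, the norm of `e^{-T} (H - E) e^{T}` as a form on the span of the
excited determinants. -/
def continuityConst (mol : Molecule) (E : ℝ) (t : CoeffSpace B h) : ℝ≥0∞ :=
  ⨆ (Φ : FCISpace N B) (_ : Φ ∈ excitedSubspace B h ∧ Φ ≠ 0)
    (Ψ : FCISpace N B) (_ : Ψ ∈ excitedSubspace B h ∧ Ψ ≠ 0),
      ‖shiftedForm mol E (NormedSpace.exp (-clusterAdj t) Φ) (NormedSpace.exp (clusterOp t) Ψ)‖ₑ /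
        (‖Φ‖ₑ * ‖Ψ‖ₑ)

/-- The Lipschitz continuity function `L_t(δ)` of the derivative of the coupled cluster function. -/
def lipschitzFun (mol : Molecule) (t : CoeffSpace B h) (δ : ℝ) : ℝ≥0∞ :=
  ⨆ (s : CoeffSpace B h) (_ : s ∈ Metric.ball t δ ∧ s ≠ t),
    ‖fderiv ℂ (ccFunction mol) t - fderiv ℂ (ccFunction mol) s‖ₑ / ‖t - s‖ₑ

/-- The radius `R`: the largest value of `min {δ, γ / (L(δ) Θ), 2 α / L(δ)}` over `δ > 0`
(with `x / 0 = ∞` for `x > 0`). -/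
def wellPosedRadius (mol : Molecule) (E : ℝ) (Ψ : FCISpace N B) (t : CoeffSpace B h) : ℝ≥0∞ :=
  ⨆ (δ : ℝ) (_ : 0 < δ), min (ENNReal.ofReal δ)
    (min (infSupConst mol E Ψ / (lipschitzFun mol t δ * thetaConst t))
      (2 * continuityConst mol E t / lipschitzFun mol t δ))

/-- `f` restricted to `U` is a smooth bijection onto its image with smooth inverse. -/
def IsDiffeoOn {V W : Type*} [NormedAddCommGroup V] [NormedSpace ℂ V] [NormedAddCommGroup W]
    [NormedSpace ℂ W] (f : V → W) (U : Set V) : Prop :=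
  ContDiffOn ℂ ∞ f U ∧ Set.InjOn f U ∧
    ∃ g : W → V, (∀ x ∈ U, g (f x) = x) ∧ ContDiffOn ℂ ∞ g (f '' U)

end CoupledCluster

end

open CoupledCluster

noncomputable section

set_option linter.unusedSectionVars false

/-! The heart of the matter is a lower bound for the derivative `Df(t)` at the zero, fed into a
quantitative inverse function theorem in finite dimension. On the approximation space the form of
`H` is represented by a linear operator, symmetric for the `L²` inner product, and `f(t)` is the
functional induced by `e^{-T} H e^{T} Ψ₀`. Excitation operators commute, so `f(t + w)` is the
coupled cluster function of the conjugated Hamiltonian `X = e^{-T} H e^{T}` at `w`, and `Df(t) w` is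
induced by the commutator `(X W - W X) Ψ₀`, with `W` the cluster operator of `w`. When `e^{T} Ψ₀` is
an eigenfunction, `X Ψ₀ = E Ψ₀`, and the derivative becomes the form of `e^{-T} (H - E) e^{T}`
between excited vectors. Its norm is at most `α`.

For the lower bound (`infSupConst_mul_le`), `e^{T} W Ψ₀` is projected onto the `L²`-complement of
`Ψ`, where `H - E` satisfies the inf-sup condition with constant `γ`. Subtracting a multiple of `Ψ`
is harmless because `H - E` kills it, and `P₀^⊥ e^{-T}` recovers `W Ψ₀`. Test vectors orthogonal to
`Ψ` are carried by `e^{T†}` to vectors orthogonal to `Ψ₀`, which are exactly the excited ones. The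
two operator norms multiply to `Θ`, so `‖Df(t) w‖ ≥ (γ/Θ) ‖w‖`. Nondegeneracy makes `γ` positive.

With `r = ‖s - t‖` and `L = L(δ)`, the Taylor remainder at `t` is at most `L r² / 2`. Inside the
ball of radius `R` this is at most half of the lower bound `(γ/Θ) r` and at most `α r`, which gives
the two-sided estimate (`ccFunction_bounds`). The derivative moves by less than `γ/Θ`, which gives
injectivity, invertible derivatives and an open image (`isOpen_image_and_isDiffeoOn`).

All of this needs the energy form to be genuinely sesquilinear, that is, the Coulomb terms to be
integrable on Slater determinants. A Hardy-type inequality on `H¹(ℝ³)`, uniform in the position of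
the centre (`lintegral_coulomb_le`), supplies this through Fubini. -/

namespace CoupledCluster

/-! ### The Coulomb form bound on `H¹(ℝ³)`. -/

section

/-- Convolution of `u` with the kernel `φ`. -/
def mollify (φ : E3 → ℝ) (u : E3 → ℂ) (x : E3) : ℂ := ∫ y, φ (x - y) • u y

theorem mollify_eq_convolution (φ : E3 → ℝ) (u : E3 → ℂ) :
    mollify φ u = convolution u φ (ContinuousLinearMap.lsmul ℝ ℝ).flip volume := rfl

theorem continuous_mollify {φ : E3 → ℝ} (hφ : ContDiff ℝ ∞ φ) (hc : HasCompactSupport φ)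
    (u : L2 E3) : Continuous (mollify φ u) := by
  rw [mollify_eq_convolution]
  exact hc.continuous_convolution_right _ ((Lp.memLp u).locallyIntegrable (by norm_num))
    hφ.continuous

/-- The derivative falls on the kernel, and `y ↦ φ (x - y)` is an admissible test function for the
weak derivative. The sign from the chain rule cancels the sign in the definition of the weak
derivative. -/
theorem hasLineDerivAt_mollify {φ : E3 → ℝ} (hφ : ContDiff ℝ ∞ φ) (hc : HasCompactSupport φ)
    {b : E3} {u g : L2 E3} (h : IsWeakPartial b u g) (x : E3) :
    HasLineDerivAt ℝ (mollify φ u) (mollify φ g x) x b := by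
  have hu := (Lp.memLp u).locallyIntegrable (by norm_num)
  have h1 := hc.hasFDerivAt_convolution_right (ContinuousLinearMap.lsmul ℝ ℝ).flip hu
    (hφ.of_le (by simp)) x
  have h2 := h1.hasLineDerivAt b
  rw [← mollify_eq_convolution] at h2
  convert! h2 using 1
  have hi := (hc.fderiv (𝕜 := ℝ)).convolutionExists_right
    (ContinuousLinearMap.precompR E3 (ContinuousLinearMap.lsmul ℝ ℝ).flip) hu
    (hφ.continuous_fderiv (by simp)) x
  rw [convolution, ContinuousLinearMap.integral_apply hi]
  have hsub : ContDiff ℝ ∞ fun y : E3 => x - y := contDiff_const.sub contDiff_id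
  have hη := hφ.comp hsub
  have hcl : HasCompactSupport (φ ∘ fun y => x - y) :=
    hc.comp_homeomorph (Homeomorph.subLeft x)
  have h3 := h _ hη hcl
  have hd (y : E3) : fderiv ℝ (φ ∘ fun y => x - y) y b = -fderiv ℝ φ (x - y) b := by
    have h4 := ((hφ.differentiable (by simp)) (x - y)).hasFDerivAt.comp y
      ((hasFDerivAt_id y).const_sub x)
    rw [h4.fderiv]; simp
  simp only [hd, neg_smul, integral_neg, neg_inj] at h3
  exact h3.symm

/-- Young's inequality for a kernel of mass one: Cauchy–Schwarz with respect to the weight `|φ (x -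
·)|`, then Tonelli. -/
theorem lintegral_mollify_sq_le {φ : E3 → ℝ} (hφ : Continuous φ)
    (h1 : ∫⁻ x, ‖φ x‖ₑ = 1) (u : L2 E3) :
    ∫⁻ x, ‖mollify φ u x‖ₑ ^ 2 ≤ ∫⁻ x, ‖u x‖ₑ ^ 2 := by
  have hum : Measurable u := (Lp.stronglyMeasurable u).measurable
  have key (x : E3) : ‖mollify φ u x‖ₑ ^ 2 ≤ ∫⁻ y, ‖φ (x - y)‖ₑ * ‖u y‖ₑ ^ 2 := by
    have hm1 : AEMeasurable (fun y => ‖φ (x - y)‖ₑ) volume :=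
      (hφ.comp (continuous_const.sub continuous_id)).measurable.enorm.aemeasurable
    have hm2 : AEMeasurable (fun y => ‖φ (x - y)‖ₑ * ‖u y‖ₑ ^ 2) volume :=
      hm1.mul (hum.enorm.pow_const 2).aemeasurable
    have h2 := ENNReal.lintegral_mul_norm_pow_le hm1 hm2 (p := 1 / 2) (q := 1 / 2)
      (by norm_num) (by norm_num) (by norm_num)
    rw [lintegral_sub_left_eq_self (fun y => ‖φ y‖ₑ) x, h1, ENNReal.one_rpow, one_mul] at h2
    have h3 (y : E3) : ‖φ (x - y)‖ₑ ^ (1 / 2 : ℝ) * (‖φ (x - y)‖ₑ * ‖u y‖ₑ ^ 2) ^ (1 / 2 : ℝ)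
        = ‖φ (x - y) • u y‖ₑ := by
      rw [ENNReal.mul_rpow_of_nonneg _ _ (by norm_num), ← mul_assoc, ← ENNReal.mul_rpow_of_nonneg _ _
        (by norm_num), ← sq, ← ENNReal.rpow_natCast, ← ENNReal.rpow_natCast, ← ENNReal.rpow_mul,
        ← ENNReal.rpow_mul, enorm_smul]
      norm_num
    simp only [h3] at h2
    have h4 := (enorm_integral_le_lintegral_enorm (μ := volume) fun y => φ (x - y) • u y).trans h2
    calc ‖mollify φ u x‖ₑ ^ 2 ≤ ((∫⁻ y, ‖φ (x - y)‖ₑ * ‖u y‖ₑ ^ 2) ^ (1 / 2 : ℝ)) ^ 2 := by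
          gcongr; exact h4
      _ = _ := by
          rw [← ENNReal.rpow_natCast, ← ENNReal.rpow_mul]; norm_num
  refine (lintegral_mono key).trans ?_
  rw [lintegral_lintegral_swap]
  · refine le_of_eq (lintegral_congr fun y => ?_)
    have hm : Measurable fun x => ‖φ (x - y)‖ₑ :=
      (hφ.comp (continuous_id.sub continuous_const)).measurable.enorm
    rw [lintegral_mul_const _ hm,
      lintegral_sub_right_eq_self (fun y => ‖φ y‖ₑ) y, h1, one_mul]
  · refine Measurable.aemeasurable ?_
    refine ((hφ.comp (continuous_fst.sub continuous_snd)).measurable.enorm).mul ?_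
    exact (hum.comp measurable_snd).enorm.pow_const 2

theorem memLp_mollify {φ : E3 → ℝ} (hφ : ContDiff ℝ ∞ φ) (hc : HasCompactSupport φ)
    (h1 : ∫⁻ x, ‖φ x‖ₑ = 1) (u : L2 E3) :
    MemLp (mollify φ u) 2 volume := by
  refine ⟨(continuous_mollify hφ hc u).aestronglyMeasurable, ?_⟩
  have h2 := (Lp.memLp u).2
  rw [eLpNorm_lt_top_iff_lintegral_rpow_enorm_lt_top (by simp) (by simp)] at h2 ⊢
  simp only [ENNReal.toReal_ofNat, ENNReal.rpow_ofNat] at h2 ⊢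
  exact (lintegral_mollify_sq_le hφ.continuous h1 u).trans_lt h2

/-- The regularised Coulomb kernel. -/
def softCoulomb (d : ℝ) (a x : E3) : ℝ := (Real.sqrt (‖x - a‖ ^ 2 + d ^ 2))⁻¹

section
variable {d : ℝ} (hd : 0 < d) (a : E3)
include hd

theorem softCoulomb_pos (x : E3) : 0 < softCoulomb d a x := by unfold softCoulomb; positivity

theorem softCoulomb_le (x : E3) : softCoulomb d a x ≤ d⁻¹ := by
  unfold softCoulomb
  gcongr
  exact Real.le_sqrt_of_sq_le (by nlinarith [sq_nonneg ‖x - a‖])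

theorem continuous_softCoulomb : Continuous (softCoulomb d a) := by
  unfold softCoulomb
  refine Continuous.inv₀ (by fun_prop) fun x => ?_
  positivity

theorem norm_mul_softCoulomb_le (x : E3) : ‖x - a‖ * softCoulomb d a x ≤ 1 := by
  unfold softCoulomb
  rw [← div_eq_mul_inv]
  refine div_le_one_of_le₀ (Real.le_sqrt_of_sq_le (by nlinarith)) (by positivity)

/-- The vector field `(x - a) / √(|x - a|² + d²)` is bounded by one, and its divergence dominates
the regularised Coulomb kernel. Here one diagonal term of that divergence is computed. -/
theorem hasLineDerivAt_coord_mul_softCoulomb (i : Fin 3) (x : E3) :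
    HasLineDerivAt ℝ (fun x : E3 => (x - a) i * softCoulomb d a x)
      (softCoulomb d a x - (x - a) i ^ 2 * softCoulomb d a x ^ 3) x (spDir i) := by
  have hn (s : ℝ) : ‖x + s • spDir i - a‖ ^ 2 = ‖x - a‖ ^ 2 + 2 * s * (x - a) i + s ^ 2 := by
    have : x + s • spDir i - a = (x - a) + s • spDir i := by abel
    rw [this, norm_add_sq_real, norm_smul, inner_smul_right]
    simp [spDir, EuclideanSpace.inner_single_right]
    ring
  have hf : (fun s : ℝ => (x + s • spDir i - a) i * softCoulomb d a (x + s • spDir i)) =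
      fun s => ((x - a) i + s) *
        (Real.sqrt (‖x - a‖ ^ 2 + 2 * s * (x - a) i + s ^ 2 + d ^ 2))⁻¹ := by
    funext s
    rw [softCoulomb, hn]
    congr 1
    simp [spDir]; ring
  rw [HasLineDerivAt, hf]
  have hp : ‖x - a‖ ^ 2 + 2 * (0 : ℝ) * (x - a) i + (0 : ℝ) ^ 2 + d ^ 2 ≠ 0 := by
    simp only [mul_zero, zero_mul, add_zero, ne_eq, OfNat.ofNat_ne_zero, not_false_eq_true, zero_pow]
    positivity
  have h1 : HasDerivAt (fun s : ℝ => ‖x - a‖ ^ 2 + 2 * s * (x - a) i + s ^ 2 + d ^ 2)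
      (2 * (x - a) i) 0 := by
    have := ((((hasDerivAt_id (0 : ℝ)).const_mul 2).mul_const ((x - a) i)).const_add
      (‖x - a‖ ^ 2)).add (hasDerivAt_pow 2 (0 : ℝ)) |>.add_const (d ^ 2)
    simpa using! this
  have h2 := (h1.sqrt hp).inv (by
    simp only [mul_zero, zero_mul, add_zero, ne_eq, OfNat.ofNat_ne_zero, not_false_eq_true, zero_pow]
    positivity)
  have h3 := ((hasDerivAt_id (0 : ℝ)).const_add ((x - a) i)).mul h2
  refine h3.congr_deriv ?_
  simp only [softCoulomb, id, Pi.inv_apply, mul_zero, zero_mul, add_zero, ne_eq, OfNat.ofNat_ne_zero,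
    not_false_eq_true, zero_pow]
  have hs : Real.sqrt (‖x - a‖ ^ 2 + d ^ 2) ≠ 0 := by positivity
  field_simp
  ring

/-- Writing `k` for the kernel, the divergence is `3 k - |x - a|² k³`, and `|x - a| k ≤ 1`. -/
theorem two_mul_softCoulomb_le (x : E3) : 2 * softCoulomb d a x ≤
    ∑ i : Fin 3, (softCoulomb d a x - (x - a) i ^ 2 * softCoulomb d a x ^ 3) := by
  have h : ∑ i : Fin 3, (x - a) i ^ 2 = ‖x - a‖ ^ 2 := by
    rw [EuclideanSpace.norm_sq_eq]; simp
  rw [Finset.sum_sub_distrib, ← Finset.sum_mul, h]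
  have h1 := norm_mul_softCoulomb_le hd a x
  have h2 := softCoulomb_pos hd a x
  have h3 : (‖x - a‖ * softCoulomb d a x) ^ 2 ≤ 1 := pow_le_one₀ (by positivity) h1
  simp only [Finset.sum_const, Finset.card_univ, Fintype.card_fin, nsmul_eq_mul]
  push_cast
  nlinarith

/-- Hardy-type inequality by the divergence trick: `|v|²` is integrated against the divergence of
the bounded field, the derivative is moved onto `|v|²`, and `2 |v| |∂ᵢ v| ≤ |v|² + |∂ᵢ v|²`. Nothing
on the right depends on `d` or `a`. -/
theorem integral_softCoulomb_le {v : E3 → ℂ} {v' : Fin 3 → E3 → ℂ} (hv : MemLp v 2 volume)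
    (hv' : ∀ i, MemLp (v' i) 2 volume)
    (hd' : ∀ i x, HasLineDerivAt ℝ v (v' i x) x (spDir i)) :
    2 * ∫ x, softCoulomb d a x * ‖v x‖ ^ 2 ≤
      ∑ i, ((∫ x, ‖v x‖ ^ 2) + ∫ x, ‖v' i x‖ ^ 2) := by
  have hv2 : Integrable fun x => ‖v x‖ ^ 2 := (memLp_two_iff_integrable_sq_norm hv.1).1 hv
  have hv2' (i : Fin 3) : Integrable fun x => ‖v' i x‖ ^ 2 :=
    (memLp_two_iff_integrable_sq_norm (hv' i).1).1 (hv' i)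
  have hcont := continuous_softCoulomb hd a
  have hk : Integrable fun x => softCoulomb d a x * ‖v x‖ ^ 2 := by
    refine hv2.bdd_mul hcont.aestronglyMeasurable (c := d⁻¹) (.of_forall fun x => ?_)
    rw [Real.norm_of_nonneg (softCoulomb_pos hd a x).le]
    exact softCoulomb_le hd a x
  have hci (i : Fin 3) (x : E3) : |(x - a) i| * softCoulomb d a x ≤ 1 :=
    (mul_le_mul_of_nonneg_right (PiLp.norm_apply_le (x - a) i) (softCoulomb_pos hd a x).le).trans
      (norm_mul_softCoulomb_le hd a x)
  have hF (i : Fin 3) : Continuous fun x : E3 => (x - a) i * softCoulomb d a x := by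
    fun_prop
  have hFb (i : Fin 3) (x : E3) : ‖(x - a) i * softCoulomb d a x‖ ≤ 1 := by
    rw [norm_mul, Real.norm_of_nonneg (softCoulomb_pos hd a x).le]
    exact hci i x
  have hdiv (i : Fin 3) : Integrable fun x =>
      (softCoulomb d a x - (x - a) i ^ 2 * softCoulomb d a x ^ 3) * ‖v x‖ ^ 2 := by
    refine hv2.bdd_mul (Continuous.aestronglyMeasurable (by fun_prop)) (c := d⁻¹)
      (.of_forall fun x => ?_)
    have h1 : ((x - a) i * softCoulomb d a x) ^ 2 ≤ 1 := by
      rw [sq_le_one_iff_abs_le_one]; exact hFb i x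
    have h2 := softCoulomb_pos hd a x
    have h3 := softCoulomb_le hd a x
    rw [Real.norm_eq_abs, abs_le]
    constructor <;> nlinarith [mul_nonneg h2.le (sq_nonneg ((x - a) i * softCoulomb d a x))]
  have hin (i : Fin 3) : Integrable fun x =>
      (x - a) i * softCoulomb d a x * (2 * inner ℝ (v x) (v' i x)) := by
    refine Integrable.bdd_mul ?_ (hF i).aestronglyMeasurable (.of_forall (hFb i))
    refine Integrable.const_mul ?_ 2
    have := MemLp.integrable_mul hv.norm (hv' i).norm
    refine this.mono' (hv.1.inner (hv' i).1) (.of_forall fun x => ?_)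
    exact norm_inner_le_norm _ _
  have hF2 (i : Fin 3) : Integrable fun x => (x - a) i * softCoulomb d a x * ‖v x‖ ^ 2 :=
    hv2.bdd_mul (hF i).aestronglyMeasurable (.of_forall (hFb i))
  have hparts (i : Fin 3) :=
    integral_bilinear_hasLineDerivAt_right_eq_neg_left_of_integrable
      (B := ContinuousLinearMap.mul ℝ ℝ) (μ := volume) (v := spDir i)
      (f := fun x => (x - a) i * softCoulomb d a x) (g := fun x => ‖v x‖ ^ 2)
      (f' := fun x => softCoulomb d a x - (x - a) i ^ 2 * softCoulomb d a x ^ 3)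
      (g' := fun x => 2 * inner ℝ (v x) (v' i x)) (hdiv i) (hin i) (hF2 i)
      (fun x _ => hasLineDerivAt_coord_mul_softCoulomb hd a i x)
      (fun x _ => by
        have := HasDerivAt.norm_sq (hd' i x)
        simpa [HasLineDerivAt] using this)
  simp only [ContinuousLinearMap.mul_apply'] at hparts
  calc 2 * ∫ x, softCoulomb d a x * ‖v x‖ ^ 2
      = ∫ x, 2 * (softCoulomb d a x * ‖v x‖ ^ 2) := (integral_const_mul _ _).symm
    _ ≤ ∫ x, ∑ i, (softCoulomb d a x - (x - a) i ^ 2 * softCoulomb d a x ^ 3) * ‖v x‖ ^ 2 := by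
        refine integral_mono (hk.const_mul 2) (integrable_finsetSum _ fun i _ => hdiv i) fun x => ?_
        simp only
        rw [← Finset.sum_mul, ← mul_assoc]
        exact mul_le_mul_of_nonneg_right (two_mul_softCoulomb_le hd a x) (by positivity)
    _ = ∑ i, -∫ x, (x - a) i * softCoulomb d a x * (2 * inner ℝ (v x) (v' i x)) := by
        rw [integral_finsetSum _ fun i _ => hdiv i]
        exact Finset.sum_congr rfl fun i _ => by rw [hparts, neg_neg]
    _ ≤ _ := by
        refine Finset.sum_le_sum fun i _ => ?_
        rw [← integral_neg, ← integral_add hv2 (hv2' i)]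
        refine integral_mono (hin i).neg (hv2.add (hv2' i)) fun x => ?_
        have h1 := abs_real_inner_le_norm (v x) (v' i x)
        have h2 := hFb i x
        rw [Real.norm_eq_abs] at h2
        beta_reduce
        have h3 : -((x - a) i * softCoulomb d a x * (2 * inner ℝ (v x) (v' i x))) ≤
            1 * (2 * (‖v x‖ * ‖v' i x‖)) := by
          refine (neg_le_abs _).trans ?_
          rw [abs_mul, abs_mul 2, abs_two]
          gcongr
        nlinarith [sq_nonneg (‖v x‖ - ‖v' i x‖)]

end

theorem ofReal_integral_sq_norm {X : Type*} [MeasureSpace X] {u : X → ℂ} (hu : MemLp u 2 volume) :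
    ENNReal.ofReal (∫ x, ‖u x‖ ^ 2) = ∫⁻ x, ‖u x‖ₑ ^ 2 := by
  rw [ofReal_integral_eq_lintegral_ofReal ((memLp_two_iff_integrable_sq_norm hu.1).1 hu)
    (.of_forall fun x => by positivity)]
  refine lintegral_congr fun x => ?_
  rw [ENNReal.ofReal_pow (norm_nonneg _), ofReal_norm]

/-- The Coulomb potential is form bounded on `H¹(ℝ³)`, uniformly in the position of the centre. -/
theorem lintegral_coulomb_le (u : SingleH1) (a : E3) :
    ∫⁻ x, ‖u.toL2 x‖ₑ ^ 2 * ENNReal.ofReal ‖x - a‖⁻¹ ≤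
      ∑ i, ((∫⁻ x, ‖u.toL2 x‖ₑ ^ 2) + ∫⁻ x, ‖u.grad i x‖ₑ ^ 2) := by
  set C := ∑ i, ((∫⁻ x, ‖u.toL2 x‖ₑ ^ 2) + ∫⁻ x, ‖u.grad i x‖ₑ ^ 2) with hC
  -- The bumps shrink at rate `1 / (n + 1)`, with outer radius twice the inner one. The bounded
  -- ratio is what Lebesgue differentiation needs later. The same rate serves as regularisation
  -- parameter of the kernel.
  let ψ (n : ℕ) : ContDiffBump (0 : E3) :=
    ⟨1 / ((n : ℝ) + 1) / 2, 1 / ((n : ℝ) + 1), by positivity, half_lt_self (by positivity)⟩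
  let φ (n : ℕ) : E3 → ℝ := (ψ n).normed volume
  have hφ (n : ℕ) : ContDiff ℝ ∞ (φ n) := (ψ n).contDiff_normed
  have hc (n : ℕ) : HasCompactSupport (φ n) := (ψ n).hasCompactSupport_normed
  have h0 (n : ℕ) (x : E3) : 0 ≤ φ n x := (ψ n).nonneg_normed x
  have h1 (n : ℕ) : ∫⁻ x, ‖φ n x‖ₑ = 1 := by
    have := ofReal_integral_eq_lintegral_ofReal ((ψ n).integrable_normed (μ := volume))
      (.of_forall (h0 n))
    rw [(ψ n).integral_normed, ENNReal.ofReal_one] at this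
    rw [this]
    exact lintegral_congr fun x => Real.enorm_of_nonneg (h0 n x)
  have hdn (n : ℕ) : (0 : ℝ) < 1 / ((n : ℝ) + 1) := by positivity
  have hbd (n : ℕ) : ∫⁻ x, ‖mollify (φ n) u.toL2 x‖ₑ ^ 2 *
      ENNReal.ofReal (softCoulomb (1 / ((n : ℝ) + 1)) a x) ≤ C := by
    have hm := memLp_mollify (hφ n) (hc n) (h1 n)
    have hv := hm u.toL2
    have h2 := integral_softCoulomb_le (hdn n) a hv (fun i => hm (u.grad i))
      fun i x => hasLineDerivAt_mollify (hφ n) (hc n) (u.isWeakPartial i) x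
    have h3 : ∫⁻ x, ‖mollify (φ n) u.toL2 x‖ₑ ^ 2 *
        ENNReal.ofReal (softCoulomb (1 / ((n : ℝ) + 1)) a x) =
        ENNReal.ofReal (∫ x, softCoulomb (1 / ((n : ℝ) + 1)) a x * ‖mollify (φ n) u.toL2 x‖ ^ 2) := by
      rw [ofReal_integral_eq_lintegral_ofReal]
      · refine lintegral_congr fun x => ?_
        rw [ENNReal.ofReal_mul (softCoulomb_pos (hdn n) a x).le, ENNReal.ofReal_pow (norm_nonneg _),
          ofReal_norm, mul_comm]
      · refine ((memLp_two_iff_integrable_sq_norm hv.1).1 hv).bdd_mul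
          (continuous_softCoulomb (hdn n) a).aestronglyMeasurable (c := (1 / ((n : ℝ) + 1))⁻¹)
          (.of_forall fun x => ?_)
        rw [Real.norm_of_nonneg (softCoulomb_pos (hdn n) a x).le]
        exact softCoulomb_le (hdn n) a x
      · exact .of_forall fun x => mul_nonneg (softCoulomb_pos (hdn n) a x).le (by positivity)
    rw [h3]
    -- The factor 2 in `h2` is given away.
    have h4 : ∫ x, softCoulomb (1 / ((n : ℝ) + 1)) a x * ‖mollify (φ n) u.toL2 x‖ ^ 2 ≤
        ∑ i, ((∫ x, ‖mollify (φ n) u.toL2 x‖ ^ 2) + ∫ x, ‖mollify (φ n) (u.grad i) x‖ ^ 2) := by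
      have : 0 ≤ ∫ x, softCoulomb (1 / ((n : ℝ) + 1)) a x * ‖mollify (φ n) u.toL2 x‖ ^ 2 :=
        integral_nonneg fun x => mul_nonneg (softCoulomb_pos (hdn n) a x).le (by positivity)
      linarith
    refine (ENNReal.ofReal_le_ofReal h4).trans ?_
    rw [ENNReal.ofReal_sum_of_nonneg fun i _ => by positivity, hC]
    refine Finset.sum_le_sum fun i _ => ?_
    rw [ENNReal.ofReal_add (by positivity) (by positivity), ofReal_integral_sq_norm hv,
      ofReal_integral_sq_norm (hm (u.grad i))]
    exact add_le_add (lintegral_mollify_sq_le (hφ n).continuous (h1 n) _)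
      (lintegral_mollify_sq_le (hφ n).continuous (h1 n) _)
  have hlim : ∀ᵐ x : E3, Filter.Tendsto (fun n => ‖mollify (φ n) u.toL2 x‖ₑ ^ 2 *
      ENNReal.ofReal (softCoulomb (1 / ((n : ℝ) + 1)) a x)) Filter.atTop
      (nhds (‖u.toL2 x‖ₑ ^ 2 * ENNReal.ofReal ‖x - a‖⁻¹)) := by
    have ha := ContDiffBump.ae_convolution_tendsto_right_of_locallyIntegrable (φ := ψ)
      (l := Filter.atTop) (K := 2) (g := u.toL2) (μ := volume)
      tendsto_one_div_add_atTop_nhds_zero_nat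
      (.of_forall fun n => by simp only [ψ]; linarith)
      ((Lp.memLp u.toL2).locallyIntegrable (by norm_num))
    filter_upwards [ha, compl_mem_ae_iff.2 (measure_singleton a)] with x hx hxa
    have hxa : x - a ≠ 0 := sub_ne_zero.2 hxa
    refine ENNReal.Tendsto.mul ?_ (Or.inr ENNReal.ofReal_ne_top) ?_ (Or.inr ?_)
    · refine ENNReal.Tendsto.pow ((continuous_enorm.tendsto _).comp (hx.congr fun n => ?_))
      rw [convolution_lsmul_swap]; rfl
    · refine (ENNReal.continuous_ofReal.tendsto _).comp ?_
      have h5 : Filter.Tendsto (fun n : ℕ => ‖x - a‖ ^ 2 + (1 / ((n : ℝ) + 1)) ^ 2) Filter.atTop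
          (nhds (‖x - a‖ ^ 2 + 0 ^ 2)) :=
        (tendsto_one_div_add_atTop_nhds_zero_nat.pow 2).const_add _
      have h6 := ((Real.continuous_sqrt.tendsto _).comp h5).inv₀ (by
        simpa using hxa)
      simpa [softCoulomb] using! h6
    · exact ENNReal.pow_ne_top enorm_ne_top
  -- The uniform bounds `hbd` pass to the pointwise almost everywhere limit by Fatou.
  calc ∫⁻ x, ‖u.toL2 x‖ₑ ^ 2 * ENNReal.ofReal ‖x - a‖⁻¹
      = ∫⁻ x, Filter.liminf (fun n : ℕ => ‖mollify (φ n) u.toL2 x‖ₑ ^ 2 *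
          ENNReal.ofReal (softCoulomb (1 / ((n : ℝ) + 1)) a x)) Filter.atTop :=
        lintegral_congr_ae (hlim.mono fun x hx => hx.liminf_eq.symm)
    _ ≤ Filter.liminf (fun n : ℕ => ∫⁻ x, ‖mollify (φ n) u.toL2 x‖ₑ ^ 2 *
          ENNReal.ofReal (softCoulomb (1 / ((n : ℝ) + 1)) a x)) Filter.atTop := by
        refine lintegral_liminf_le fun n => ?_
        refine ((continuous_mollify (hφ n) (hc n) _).measurable.enorm.pow_const 2).mul ?_
        exact (continuous_softCoulomb (hdn n) a).measurable.ennreal_ofReal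
    _ ≤ C := Filter.liminf_le_of_le (by isBoundedDefault) fun b hb => by
        obtain ⟨n, hn⟩ := hb.exists
        exact hn.trans (hbd n)

theorem lintegral_sq_lt_top {X : Type*} [NormedAddCommGroup X] [MeasureSpace X] (u : L2 X) : ∫⁻ x, ‖u x‖ₑ ^ 2 < ⊤ := by
  rw [← ofReal_integral_sq_norm (Lp.memLp u)]
  exact ENNReal.ofReal_lt_top

end

/-! ### Finite potential energy of Slater determinants and sesquilinearity of the energy form. -/

section

theorem enorm_prod_eq {ι : Type*} [Fintype ι] (f : ι → ℂ) : ‖∏ i, f i‖ₑ = ∏ i, ‖f i‖ₑ := by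
  simp only [← ofReal_norm, norm_prod]
  exact ENNReal.ofReal_prod_of_nonneg fun i _ => norm_nonneg _

theorem tensorH1_toL2 {N : ℕ} (g : Fin N → SingleH1) :
    (tensorH1 g).toL2 = tensorL2 fun i => (g i).toL2 := rfl

/-- Integrating first over `x j` with the other particles frozen, the one-particle bound applies
whatever the centre is. A centre that depends on the remaining coordinates lets the same lemma cover
nuclei and electron pairs. -/
theorem lintegral_tensor_mul_coulomb_lt_top {n : ℕ} (g : Fin (n + 1) → SingleH1) (j : Fin (n + 1))
    {a : (Fin n → E3) → E3} (ha : Measurable a) :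
    ∫⁻ x : Config (n + 1), ‖tensorL2 (fun i => (g i).toL2) x‖ₑ ^ 2 *
      ENNReal.ofReal ‖x j - a (j.removeNth x)‖⁻¹ < ⊤ := by
  have hm (i : Fin (n + 1)) : Measurable fun y => ‖(g i).toL2 y‖ₑ ^ 2 :=
    (Lp.stronglyMeasurable (g i).toL2).measurable.enorm.pow_const 2
  set F : Config (n + 1) → ℝ≥0∞ := fun x => (∏ i, ‖(g i).toL2 (x i)‖ₑ ^ 2) *
    ENNReal.ofReal ‖x j - a (j.removeNth x)‖⁻¹ with hF
  have hrm : Measurable fun x : Config (n + 1) => j.removeNth x :=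
    measurable_pi_lambda _ fun i => measurable_pi_apply _
  have hFm : Measurable F := by
    refine (Finset.measurable_fun_prod _ fun i _ => (hm i).comp (measurable_pi_apply i)).mul ?_
    exact ((measurable_pi_apply j).sub (ha.comp hrm)).norm.inv.ennreal_ofReal
  have h1 : ∫⁻ x : Config (n + 1), ‖tensorL2 (fun i => (g i).toL2) x‖ₑ ^ 2 *
      ENNReal.ofReal ‖x j - a (j.removeNth x)‖⁻¹ = ∫⁻ x, F x := by
    refine lintegral_congr_ae ?_
    filter_upwards [tensorL2_ae fun i => (g i).toL2] with x hx
    simp only [hx, hF, enorm_prod_eq, Finset.prod_pow]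
  have mp := (volume_preserving_piFinSuccAbove (fun _ : Fin (n + 1) => E3) j).symm
  rw [h1, ← mp.lintegral_comp hFm, Measure.volume_eq_prod,
    lintegral_prod_symm (fun z => F ((MeasurableEquiv.piFinSuccAbove (fun _ => E3) j).symm z))
      (hFm.comp mp.measurable).aemeasurable]
  set C := ∑ i, ((∫⁻ x, ‖(g j).toL2 x‖ₑ ^ 2) + ∫⁻ x, ‖(g j).grad i x‖ₑ ^ 2)
  have hC : C < ⊤ := ENNReal.sum_lt_top.2 fun i _ =>
    ENNReal.add_lt_top.2 ⟨lintegral_sq_lt_top _, lintegral_sq_lt_top _⟩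
  have hle (y : Fin n → E3) : ∫⁻ x : E3,
      F ((MeasurableEquiv.piFinSuccAbove (fun _ : Fin (n + 1) => E3) j).symm (x, y)) ≤
      C * ∏ i, ‖(g (j.succAbove i)).toL2 (y i)‖ₑ ^ 2 := by
    have h2 (x : E3) :
        F ((MeasurableEquiv.piFinSuccAbove (fun _ : Fin (n + 1) => E3) j).symm (x, y)) =
        (‖(g j).toL2 x‖ₑ ^ 2 * ENNReal.ofReal ‖x - a y‖⁻¹) *
          ∏ i, ‖(g (j.succAbove i)).toL2 (y i)‖ₑ ^ 2 := by
      simp only [hF, MeasurableEquiv.piFinSuccAbove, Fin.prod_univ_succAbove _ j,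
        Fin.insertNthEquiv]
      simp
      ring
    simp only [h2]
    have hm2 : Measurable fun x : E3 => ‖(g j).toL2 x‖ₑ ^ 2 * ENNReal.ofReal ‖x - a y‖⁻¹ :=
      (hm j).mul (measurable_id.sub_const _).norm.inv.ennreal_ofReal
    rw [lintegral_mul_const _ hm2]
    gcongr
    exact lintegral_coulomb_le (g j) (a y)
  refine (lintegral_mono hle).trans_lt ?_
  have hm3 : Measurable fun y : Fin n → E3 => ∏ i, ‖(g (j.succAbove i)).toL2 (y i)‖ₑ ^ 2 :=
    Finset.measurable_fun_prod _ fun i _ => (hm (j.succAbove i)).comp (measurable_pi_apply i)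
  rw [lintegral_const_mul _ hm3]
  refine ENNReal.mul_lt_top hC ?_
  have h3 := (lintegral_sq_lt_top (tensorL2 fun i => (g (j.succAbove i)).toL2))
  refine lt_of_eq_of_lt (lintegral_congr_ae ?_) h3
  filter_upwards [tensorL2_ae fun i => (g (j.succAbove i)).toL2] with x hx
  rw [hx, enorm_prod_eq, Finset.prod_pow]

variable {N K : ℕ} (B : SingleParticleBasis K)

theorem Molecule.measurable_potential (mol : Molecule) :
    Measurable (mol.potential : Config N → ℝ) := by
  unfold Molecule.potential
  refine Measurable.add ?_ ?_
  · exact Finset.measurable_fun_sum _ fun j _ => Finset.measurable_fun_sum _ fun α _ =>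
      measurable_const.div (measurable_const.sub (measurable_pi_apply j)).norm
  · exact Finset.measurable_fun_sum _ fun j _ => Finset.measurable_fun_sum _ fun i _ =>
      measurable_const.div ((measurable_pi_apply i).sub (measurable_pi_apply j)).norm

theorem Molecule.enorm_potential_le (mol : Molecule) (x : Config N) :
    ‖mol.potential x‖ₑ ≤
      (∑ j, ∑ α, ENNReal.ofReal (mol.charge α) * ENNReal.ofReal ‖x j - mol.pos α‖⁻¹) +
        ∑ j, ∑ i ∈ Finset.Iio j, ENNReal.ofReal ‖x j - x i‖⁻¹ := by
  unfold Molecule.potential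
  refine (enorm_add_le _ _).trans (add_le_add ?_ ?_)
  · refine (enorm_sum_le _ _).trans (Finset.sum_le_sum fun j _ => ?_)
    refine (enorm_sum_le _ _).trans (Finset.sum_le_sum fun α _ => le_of_eq ?_)
    rw [neg_div, enorm_neg, Real.enorm_of_nonneg (div_nonneg (mol.charge_pos α).le (norm_nonneg _)),
      div_eq_mul_inv, ENNReal.ofReal_mul (mol.charge_pos α).le, norm_sub_rev]
  · refine (enorm_sum_le _ _).trans (Finset.sum_le_sum fun j _ => ?_)
    refine (enorm_sum_le _ _).trans (Finset.sum_le_sum fun i _ => le_of_eq ?_)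
    rw [Real.enorm_of_nonneg (by positivity), one_div, norm_sub_rev]

theorem lintegral_mul_potential_lt_top (mol : Molecule) {w : Config N → ℝ≥0∞} (hm : Measurable w)
    (h1 : ∀ j a, ∫⁻ x, w x * ENNReal.ofReal ‖x j - a‖⁻¹ < ⊤)
    (h2 : ∀ j i, i ≠ j → ∫⁻ x, w x * ENNReal.ofReal ‖x j - x i‖⁻¹ < ⊤) :
    ∫⁻ x : Config N, w x * ‖mol.potential x‖ₑ < ⊤ := by
  have hmX (j : Fin N) (a : E3) :
      Measurable fun x : Config N => w x * ENNReal.ofReal ‖x j - a‖⁻¹ := by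
    have hj : Measurable fun x : Config N => x j := measurable_pi_apply j
    exact hm.mul (hj.sub_const a).norm.inv.ennreal_ofReal
  have hmE (j i : Fin N) : Measurable fun x : Config N => w x * ENNReal.ofReal ‖x j - x i‖⁻¹ :=
    hm.mul ((measurable_pi_apply j).sub (measurable_pi_apply i)).norm.inv.ennreal_ofReal
  refine (lintegral_mono fun x => mul_le_mul_right (mol.enorm_potential_le x) _).trans_lt ?_
  simp only [mul_add, Finset.mul_sum]
  have hm3 (j : Fin N) (α) : Measurable fun x : Config N =>
      w x * (ENNReal.ofReal (mol.charge α) * ENNReal.ofReal ‖x j - mol.pos α‖⁻¹) := by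
    simp only [mul_left_comm (w _)]
    exact (hmX j _).const_mul _
  have hm4 (j : Fin N) : Measurable fun x : Config N =>
      ∑ α, w x * (ENNReal.ofReal (mol.charge α) * ENNReal.ofReal ‖x j - mol.pos α‖⁻¹) :=
    Finset.measurable_fun_sum _ fun α _ => hm3 j α
  rw [lintegral_add_left (Finset.measurable_fun_sum _ fun j _ => hm4 j)]
  refine ENNReal.add_lt_top.2 ⟨?_, ?_⟩
  · rw [lintegral_finsetSum _ fun j _ => hm4 j]
    refine ENNReal.sum_lt_top.2 fun j _ => ?_
    rw [lintegral_finsetSum _ fun α _ => hm3 j α]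
    refine ENNReal.sum_lt_top.2 fun α _ => ?_
    simp only [mul_left_comm (w _)]
    rw [lintegral_const_mul _ (hmX j _)]
    exact ENNReal.mul_lt_top ENNReal.ofReal_lt_top (h1 j _)
  · rw [lintegral_finsetSum _ fun j _ => Finset.measurable_fun_sum _ fun i _ => hmE j i]
    refine ENNReal.sum_lt_top.2 fun j _ => ?_
    rw [lintegral_finsetSum _ fun i _ => hmE j i]
    exact ENNReal.sum_lt_top.2 fun i hi => h2 j i (Finset.mem_Iio.1 hi).ne

theorem lintegral_tensor_mul_potential_lt_top (mol : Molecule) (g : Fin N → SingleH1) :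
    ∫⁻ x : Config N, ‖tensorL2 (fun i => (g i).toL2) x‖ₑ ^ 2 * ‖mol.potential x‖ₑ < ⊤ := by
  refine lintegral_mul_potential_lt_top mol
    ((Lp.stronglyMeasurable (tensorL2 fun i => (g i).toL2)).measurable.enorm.pow_const 2) ?_ ?_
  · intro j a
    obtain _ | n := N
    · exact j.elim0
    · exact lintegral_tensor_mul_coulomb_lt_top g j (a := fun _ => a) measurable_const
  · intro j i hij
    obtain _ | n := N
    · exact j.elim0
    -- As `i ≠ j`, the position of electron `i` is one of the frozen coordinates.
    · obtain ⟨i', rfl⟩ := Fin.exists_succAbove_eq hij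
      exact lintegral_tensor_mul_coulomb_lt_top g j (a := fun y => y i') (measurable_pi_apply i')

/-- The functions with finite absolute potential energy. -/
def finitePotential (mol : Molecule) (N : ℕ) : Submodule ℂ (ManyH1 N) where
  -- Placing `√|V|` next to `u` turns the quadratic condition `∫ |V| |u|² < ∞` into membership in a
  -- linear space, and Cauchy–Schwarz then makes the mixed integrals converge.
  carrier := {u | MemLp (fun x => ((Real.sqrt |mol.potential x| : ℝ) : ℂ) * u.toL2 x) 2 volume}
  add_mem' := fun {u v} hu hv => by
    refine (MemLp.add hu hv).ae_eq ?_
    filter_upwards [Lp.coeFn_add u.toL2 v.toL2] with x hx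
    rw [map_add, hx]
    simp [mul_add]
  zero_mem' := by
    refine (MemLp.zero' : MemLp (fun _ : Config N => (0 : ℂ)) 2 volume).ae_eq ?_
    filter_upwards [Lp.coeFn_zero ℂ 2 (volume : Measure (Config N))] with x hx
    rw [map_zero, hx]
    simp
  smul_mem' := fun c u hu => by
    refine (MemLp.const_smul hu c).ae_eq ?_
    filter_upwards [Lp.coeFn_smul c u.toL2] with x hx
    rw [map_smul, hx]
    simp only [Pi.smul_apply, smul_eq_mul]
    ring

theorem tensorH1_mem_finitePotential (mol : Molecule) (g : Fin N → SingleH1) :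
    tensorH1 g ∈ finitePotential mol N := by
  refine ⟨((Complex.measurable_ofReal.comp
    (mol.measurable_potential.abs.sqrt)).mul
    (Lp.stronglyMeasurable (tensorH1 g).toL2).measurable).aestronglyMeasurable, ?_⟩
  rw [eLpNorm_lt_top_iff_lintegral_rpow_enorm_lt_top (by simp) (by simp)]
  refine lt_of_eq_of_lt (lintegral_congr fun x => ?_) (lintegral_tensor_mul_potential_lt_top mol g)
  simp only [ENNReal.toReal_ofNat, ENNReal.rpow_ofNat]
  have h : ‖((Real.sqrt |mol.potential x| : ℝ) : ℂ)‖ₑ ^ 2 = ‖mol.potential x‖ₑ := by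
    rw [← enorm_pow, ← Complex.ofReal_pow, Real.sq_sqrt (abs_nonneg _), ← ofReal_norm,
      Complex.norm_real, Real.norm_eq_abs, abs_abs, ← Real.norm_eq_abs, ofReal_norm]
  rw [enorm_mul, mul_pow, mul_comm, h, tensorH1_toL2]

theorem fciSubmodule_le_finitePotential (mol : Molecule) :
    fciSubmodule N B ≤ finitePotential mol N := by
  refine Submodule.span_le.2 ?_
  rintro _ ⟨k, rfl⟩
  exact Submodule.smul_mem _ _ (Submodule.sum_mem _ fun π _ =>
    Submodule.smul_mem _ _ (tensorH1_mem_finitePotential mol _))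

theorem integrable_potential_mul {mol : Molecule} {u v : ManyH1 N}
    (hu : u ∈ finitePotential mol N) (hv : v ∈ finitePotential mol N) :
    Integrable fun x => (mol.potential x : ℂ) * (conj (u.toL2 x) * v.toL2 x) := by
  have h := MemLp.integrable_mul (MemLp.norm hu) (MemLp.norm hv)
  refine h.mono' ?_ (.of_forall fun x => ?_)
  · refine Measurable.aestronglyMeasurable ?_
    exact (Complex.measurable_ofReal.comp mol.measurable_potential).mul
      ((Complex.continuous_conj.measurable.comp (Lp.stronglyMeasurable u.toL2).measurable).mul
        (Lp.stronglyMeasurable v.toL2).measurable)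
  · have hs := Real.mul_self_sqrt (abs_nonneg (mol.potential x))
    simp only [Pi.mul_apply, norm_mul, Complex.norm_real, Real.norm_eq_abs, RCLike.norm_conj,
      abs_of_nonneg (Real.sqrt_nonneg _)]
    refine le_of_eq ?_
    nth_rewrite 1 [← hs]
    ring

theorem Molecule.energyForm_conj (mol : Molecule) (u v : ManyH1 N) :
    conj (mol.energyForm u v) = mol.energyForm v u := by
  unfold Molecule.energyForm
  rw [map_add, map_mul, map_sum, ← integral_conj]
  congr 1
  · simp only [map_div₀, map_one, inner_conj_symm, map_ofNat]
  · refine integral_congr_ae (.of_forall fun x => ?_)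
    simp only [map_mul, Complex.conj_ofReal, Complex.conj_conj]
    ring

/-- This is where finite potential energy is indispensable: the integral of a non-integrable
function is zero by convention, so additivity can fail without it. Conjugation and scalar
multiplication need no integrability. -/
theorem Molecule.energyForm_add_right {mol : Molecule} {u v w : ManyH1 N}
    (hu : u ∈ finitePotential mol N) (hv : v ∈ finitePotential mol N)
    (hw : w ∈ finitePotential mol N) :
    mol.energyForm u (v + w) = mol.energyForm u v + mol.energyForm u w := by
  unfold Molecule.energyForm
  have h : ∫ x, (mol.potential x : ℂ) * (conj (u.toL2 x) * (v + w).toL2 x) =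
      (∫ x, (mol.potential x : ℂ) * (conj (u.toL2 x) * v.toL2 x)) +
      ∫ x, (mol.potential x : ℂ) * (conj (u.toL2 x) * w.toL2 x) := by
    rw [← integral_add (integrable_potential_mul hu hv) (integrable_potential_mul hu hw)]
    refine integral_congr_ae ?_
    filter_upwards [Lp.coeFn_add v.toL2 w.toL2] with x hx
    rw [map_add, hx, Pi.add_apply]
    ring
  rw [h]
  simp only [map_add, PiLp.add_apply, inner_add_right, Finset.sum_add_distrib]
  ring

theorem Molecule.energyForm_smul_right (mol : Molecule) (u v : ManyH1 N) (c : ℂ) :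
    mol.energyForm u (c • v) = c * mol.energyForm u v := by
  unfold Molecule.energyForm
  have h : ∫ x, (mol.potential x : ℂ) * (conj (u.toL2 x) * (c • v).toL2 x) =
      c * ∫ x, (mol.potential x : ℂ) * (conj (u.toL2 x) * v.toL2 x) := by
    rw [← integral_const_mul]
    refine integral_congr_ae ?_
    filter_upwards [Lp.coeFn_smul c v.toL2] with x hx
    rw [map_smul, hx, Pi.smul_apply, smul_eq_mul]
    ring
  rw [h]
  simp only [map_smul, PiLp.smul_apply, inner_smul_right, ← Finset.mul_sum]
  ring

theorem FCISpace.toH1_mem_finitePotential (mol : Molecule) (u : FCISpace N B) :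
    u.toH1 ∈ finitePotential mol N := fciSubmodule_le_finitePotential B mol u.2

end

/-! ### Algebra of excitation operators on Slater determinants. -/

section

variable {N K : ℕ} {B : SingleParticleBasis K}

theorem overlap_add_left (u v w : FCISpace N B) :
    overlap (u + v) w = overlap u w + overlap v w := by
  simp only [overlap, l2inner, map_add, inner_add_left]

theorem overlap_add_right (u v w : FCISpace N B) :
    overlap u (v + w) = overlap u v + overlap u w := by
  simp only [overlap, l2inner, map_add, inner_add_right]

theorem overlap_smul_left (c : ℂ) (u v : FCISpace N B) :
    overlap (c • u) v = conj c * overlap u v := by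
  simp only [overlap, l2inner, map_smul, inner_smul_left]

theorem overlap_smul_right (c : ℂ) (u v : FCISpace N B) :
    overlap u (c • v) = c * overlap u v := by
  simp only [overlap, l2inner, map_smul, inner_smul_right]

/-- The overlap with a fixed first argument. -/
def overlapRight (u : FCISpace N B) : FCISpace N B →ₗ[ℂ] ℂ where
  toFun v := overlap u v
  map_add' := overlap_add_right u
  map_smul' c v := overlap_smul_right c u v

theorem conj_overlap (u v : FCISpace N B) : conj (overlap u v) = overlap v u :=
  inner_conj_symm _ _

theorem overlap_sub_right (u v w : FCISpace N B) :
    overlap u (v - w) = overlap u v - overlap u w := map_sub (overlapRight u) v w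

theorem overlap_zero_right (u : FCISpace N B) : overlap u 0 = 0 := map_zero (overlapRight u)

theorem overlap_sum_right {ι : Type*} (s : Finset ι) (u : FCISpace N B) (f : ι → FCISpace N B) :
    overlap u (∑ i ∈ s, f i) = ∑ i ∈ s, overlap u (f i) := map_sum (overlapRight u) f s

theorem overlap_zero_left (u : FCISpace N B) : overlap 0 u = 0 := by
  rw [← conj_overlap, overlap_zero_right, map_zero]

theorem overlap_sum_left {ι : Type*} (s : Finset ι) (u : FCISpace N B) (f : ι → FCISpace N B) :
    overlap (∑ i ∈ s, f i) u = ∑ i ∈ s, overlap (f i) u := by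
  rw [← conj_overlap, overlap_sum_right, map_sum]
  simp only [conj_overlap]

/-- To check a linear property it suffices to check it on Slater determinants. -/
theorem FCISpace.det_induction {p : FCISpace N B → Prop}
    (hdet : ∀ ν : Fin N → Fin K, StrictMono ν → p (FCISpace.det B ν)) (hzero : p 0)
    (hadd : ∀ u v, p u → p v → p (u + v)) (hsmul : ∀ (c : ℂ) u, p u → p (c • u))
    (u : FCISpace N B) : p u := by
  have hu : u ∈ Submodule.span ℂ (Set.range (FCISpace.basis N B)) := by
    rw [(FCISpace.basis N B).span_eq]; trivial
  refine Submodule.span_induction ?_ hzero (fun _ _ _ _ => hadd _ _) (fun c _ _ => hsmul c _) hu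
  rintro _ ⟨k, rfl⟩
  rw [FCISpace.basis_apply]
  exact hdet _ k.2

theorem FCISpace.det_perm (ν : Fin N → Fin K) (σ : Equiv.Perm (Fin N)) :
    FCISpace.det B (ν ∘ σ) = ((Equiv.Perm.sign σ : ℤ) : ℂ) • FCISpace.det B ν :=
  Subtype.ext (slater_perm B ν σ)

theorem replaceIndex_comp_injective {I L : Finset (Fin K)} (h : I.card = L.card)
    {ν : Fin N → Fin K} (hν : Function.Injective ν) (hL : ∀ l ∈ L, l ∉ Set.range ν) :
    Function.Injective (replaceIndex I L h ∘ ν) := by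
  intro p q hpq
  simp only [Function.comp_apply] at hpq
  by_cases hp : ν p ∈ I <;> by_cases hq : ν q ∈ I
  · rw [replaceIndex, dif_pos hp, replaceIndex, dif_pos hq] at hpq
    exact hν (congrArg Subtype.val ((I.orderIsoOfFin rfl).symm.injective
      ((L.orderIsoOfFin h.symm).injective (Subtype.ext hpq))))
  · rw [replaceIndex_of_notMem h hq] at hpq
    exact absurd ⟨q, hpq.symm⟩ (hL _ (replaceIndex_mem h hp))
  · rw [replaceIndex_of_notMem h hp] at hpq
    exact absurd ⟨p, hpq⟩ (hL _ (replaceIndex_mem h hq))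
  · rw [replaceIndex_of_notMem h hp, replaceIndex_of_notMem h hq] at hpq
    exact hν hpq

/-- Both substitutions match elements of equal rank in `I` and `L`, so the second undoes the first.
-/
theorem replaceIndex_replaceIndex_of_mem {I L : Finset (Fin K)} (h : I.card = L.card) {p : Fin K}
    (hp : p ∈ I) : replaceIndex L I h.symm (replaceIndex I L h p) = p := by
  have hm := replaceIndex_mem h hp
  have hq : replaceIndex I L h p =
      L.orderEmbOfFin h.symm ((I.orderIsoOfFin rfl).symm ⟨p, hp⟩) := by
    rw [replaceIndex, dif_pos hp, Finset.coe_orderIsoOfFin_apply]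
  rw [replaceIndex, dif_pos hm]
  set m := (I.orderIsoOfFin rfl).symm ⟨p, hp⟩ with hmdef
  set m' := (L.orderIsoOfFin rfl).symm ⟨replaceIndex I L h p, hm⟩ with hm'def
  have h1 : (L.orderEmbOfFin rfl m' : Fin K) = L.orderEmbOfFin h.symm m := by
    rw [← hq, ← Finset.coe_orderIsoOfFin_apply, hm'def, OrderIso.apply_symm_apply]
  -- The ranks `m` and `m'` live in `Fin` of different cardinality expressions, so they are compared
  -- as natural numbers.
  rw [Finset.orderEmbOfFin_eq_orderEmbOfFin_iff] at h1
  have h2 : (I.orderEmbOfFin h.symm.symm m' : Fin K) = I.orderEmbOfFin rfl m :=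
    Finset.orderEmbOfFin_eq_orderEmbOfFin_iff.2 h1
  rw [Finset.coe_orderIsoOfFin_apply, h2, ← Finset.coe_orderIsoOfFin_apply, hmdef,
    OrderIso.apply_symm_apply]

theorem exists_replaceIndex_eq {I L : Finset (Fin K)} (h : I.card = L.card) {l : Fin K}
    (hl : l ∈ L) : ∃ i ∈ I, replaceIndex I L h i = l :=
  ⟨_, replaceIndex_mem h.symm hl, replaceIndex_replaceIndex_of_mem h.symm hl⟩

-- Substitution acts in place, hence commutes with reordering the tuple, and sorting contributes the
-- same sign on both sides. Composing two substitutions requires this, since the first one need not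
-- leave a sorted tuple.
open scoped Classical in
theorem substitutionOp_det_of_injective (I L : Finset (Fin K)) (h : I.card = L.card)
    {ν : Fin N → Fin K} (hν : Function.Injective ν) :
    substitutionOp N B I L h (FCISpace.det B ν) =
      if (∀ i ∈ I, i ∈ Set.range ν) ∧ ∀ l ∈ L, l ∉ Set.range ν then
        FCISpace.det B (replaceIndex I L h ∘ ν) else 0 := by
  have hm : StrictMono (ν ∘ Tuple.sort ν) :=
    (Tuple.monotone_sort ν).strictMono_of_injective (hν.comp (Tuple.sort ν).injective)
  have hr : Set.range (ν ∘ Tuple.sort ν) = Set.range ν := (Tuple.sort ν).surjective.range_comp ν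
  have h1 : ν = (ν ∘ Tuple.sort ν) ∘ ((Tuple.sort ν)⁻¹ : Equiv.Perm (Fin N)) := by
    funext i; simp
  conv_lhs => rw [h1, FCISpace.det_perm, map_smul, substitutionOp_det B I L h _ hm]
  simp only [hr]
  split_ifs
  · rw [← FCISpace.det_perm]
    congr 1
    funext i; simp
  · rw [smul_zero]

section
variable {I L : Finset (Fin K)} {h : I.card = L.card} {ν : Fin N → Fin K} {p : Fin K}

theorem mem_range_replaceIndex_comp_of_notMem (hp : p ∉ L) :
    p ∈ Set.range (replaceIndex I L h ∘ ν) ↔ p ∈ Set.range ν ∧ p ∉ I := by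
  constructor
  · rintro ⟨k, rfl⟩
    by_cases hk : ν k ∈ I
    · exact absurd (replaceIndex_mem h hk) hp
    · simp only [Function.comp_apply, replaceIndex_of_notMem h hk]
      exact ⟨⟨k, rfl⟩, hk⟩
  · rintro ⟨⟨k, rfl⟩, hk⟩
    exact ⟨k, replaceIndex_of_notMem h hk⟩

theorem mem_range_replaceIndex_comp_of_mem (hI : ∀ i ∈ I, i ∈ Set.range ν) (hp : p ∈ L) :
    p ∈ Set.range (replaceIndex I L h ∘ ν) := by
  obtain ⟨i, hi, rfl⟩ := exists_replaceIndex_eq h hp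
  obtain ⟨k, rfl⟩ := hI i hi
  exact ⟨k, rfl⟩

end

theorem ExcIndex.vir_notMem_occ (μ μ' : ExcIndex N K) {l : Fin K} (hl : l ∈ μ.vir) : l ∉ μ'.occ :=
  fun hi => absurd (μ'.2.1 l hi) (not_lt.2 (μ.2.2.1 l hl))

-- Occupied and virtual orbitals never overlap, so the second excitation is obstructed only by
-- orbitals the first has already removed or inserted. The resulting condition is symmetric in `μ`
-- and `μ'`, which is what commutation needs.
open scoped Classical in
theorem excitationOp_excitationOp_det (μ μ' : ExcIndex N K) {ν : Fin N → Fin K}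
    (hν : Function.Injective ν) : excitationOp B μ (excitationOp B μ' (FCISpace.det B ν)) =
      if ((∀ i ∈ μ.occ, i ∈ Set.range ν) ∧ (∀ i ∈ μ'.occ, i ∈ Set.range ν)) ∧
          ((∀ l ∈ μ.vir, l ∉ Set.range ν) ∧ (∀ l ∈ μ'.vir, l ∉ Set.range ν)) ∧
          Disjoint μ.occ μ'.occ ∧ Disjoint μ.vir μ'.vir then
        FCISpace.det B (replaceIndex μ.occ μ.vir μ.card_eq ∘
          replaceIndex μ'.occ μ'.vir μ'.card_eq ∘ ν) else 0 := by
  unfold excitationOp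
  rw [substitutionOp_det_of_injective _ _ _ hν]
  by_cases hC : (∀ i ∈ μ'.occ, i ∈ Set.range ν) ∧ ∀ l ∈ μ'.vir, l ∉ Set.range ν
  · rw [if_pos hC, substitutionOp_det_of_injective _ _ _ (replaceIndex_comp_injective _ hν hC.2)]
    refine if_congr ?_ rfl rfl
    constructor
    · rintro ⟨h1, h2⟩
      have h3 (i) (hi : i ∈ μ.occ) := (mem_range_replaceIndex_comp_of_notMem
        (fun hl => μ'.vir_notMem_occ μ hl hi)).1 (h1 i hi)
      have h4 (l) (hl : l ∈ μ.vir) : l ∉ μ'.vir := fun hl' =>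
        h2 l hl (mem_range_replaceIndex_comp_of_mem hC.1 hl')
      refine ⟨⟨fun i hi => (h3 i hi).1, hC.1⟩, ⟨fun l hl hr => h2 l hl ?_, hC.2⟩,
        Finset.disjoint_left.2 fun i hi => (h3 i hi).2, Finset.disjoint_left.2 h4⟩
      exact (mem_range_replaceIndex_comp_of_notMem (h4 l hl)).2 ⟨hr, μ.vir_notMem_occ μ' hl⟩
    · rintro ⟨⟨h1, -⟩, ⟨h2, -⟩, h3, h4⟩
      refine ⟨fun i hi => (mem_range_replaceIndex_comp_of_notMem
        (fun hl => μ'.vir_notMem_occ μ hl hi)).2 ⟨h1 i hi, Finset.disjoint_left.1 h3 hi⟩,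
        fun l hl hr => h2 l hl ?_⟩
      exact ((mem_range_replaceIndex_comp_of_notMem (Finset.disjoint_left.1 h4 hl)).1 hr).1
  · rw [if_neg hC, map_zero, if_neg fun h => hC ⟨h.1.2, h.2.1.2⟩]

theorem ExcIndex.replaceIndex_comm (μ μ' : ExcIndex N K) (hd : Disjoint μ.occ μ'.occ) (p : Fin K) :
    replaceIndex μ.occ μ.vir μ.card_eq (replaceIndex μ'.occ μ'.vir μ'.card_eq p) =
      replaceIndex μ'.occ μ'.vir μ'.card_eq (replaceIndex μ.occ μ.vir μ.card_eq p) := by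
  by_cases hp : p ∈ μ.occ
  · rw [replaceIndex_of_notMem μ'.card_eq (Finset.disjoint_left.1 hd hp),
      replaceIndex_of_notMem μ'.card_eq (μ.vir_notMem_occ μ' (replaceIndex_mem _ hp))]
  · rw [replaceIndex_of_notMem μ.card_eq hp]
    by_cases hp' : p ∈ μ'.occ
    · rw [replaceIndex_of_notMem μ.card_eq (μ'.vir_notMem_occ μ (replaceIndex_mem _ hp'))]
    · rw [replaceIndex_of_notMem μ'.card_eq hp', replaceIndex_of_notMem μ.card_eq hp]

/-- Excitation operators commute. -/
theorem excitationOp_comm (μ μ' : ExcIndex N K) (u : FCISpace N B) :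
    excitationOp B μ (excitationOp B μ' u) = excitationOp B μ' (excitationOp B μ u) := by
  classical
  refine FCISpace.det_induction (p := fun u => excitationOp B μ (excitationOp B μ' u) =
    excitationOp B μ' (excitationOp B μ u)) (fun ν hν => ?_) (by simp)
    (fun u v hu hv => by simp only [map_add, hu, hv])
    (fun c u hu => by simp only [map_smul, hu]) u
  rw [excitationOp_excitationOp_det μ μ' hν.injective,
    excitationOp_excitationOp_det μ' μ hν.injective]
  by_cases hd : Disjoint μ.occ μ'.occ
  · refine if_congr ?_ ?_ rfl
    · rw [and_comm (a := ∀ i ∈ μ.occ, _), and_comm (a := ∀ l ∈ μ.vir, _), disjoint_comm,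
        disjoint_comm (a := μ.vir)]
    · congr 1
      funext k
      exact μ.replaceIndex_comm μ' hd (ν k)
  · rw [if_neg fun h => hd h.2.2.1, if_neg fun h => hd h.2.2.1.symm]

/-- A matching of permuted tuples after substituting in `a` is equivalent to one after the inverse
substitution in `b`. This matches the terms of the two overlap expansions one by one. -/
theorem substitution_transpose {I L : Finset (Fin K)} (h : I.card = L.card) (hd : Disjoint I L)
    {a b : Fin N → Fin K} (π ρ : Equiv.Perm (Fin N))
    (hI : ∀ i ∈ I, i ∈ Set.range a) (hL : ∀ l ∈ L, l ∉ Set.range a)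
    (hab : (replaceIndex I L h ∘ a) ∘ π = b ∘ ρ) :
    ((∀ l ∈ L, l ∈ Set.range b) ∧ ∀ i ∈ I, i ∉ Set.range b) ∧
      a ∘ π = (replaceIndex L I h.symm ∘ b) ∘ ρ := by
  have hr : Set.range b = Set.range (replaceIndex I L h ∘ a) := by
    rw [← ρ.surjective.range_comp b, ← hab, π.surjective.range_comp]
  refine ⟨⟨fun l hl => ?_, fun i hi hib => ?_⟩, ?_⟩
  · rw [hr]; exact mem_range_replaceIndex_comp_of_mem hI hl
  · rw [hr, mem_range_replaceIndex_comp_of_notMem (Finset.disjoint_left.1 hd hi)] at hib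
    exact hib.2 hi
  · rw [Function.comp_assoc, ← hab]
    funext k
    simp only [Function.comp_apply]
    by_cases hk : a (π k) ∈ I
    · rw [replaceIndex_replaceIndex_of_mem h hk]
    · rw [replaceIndex_of_notMem h hk, replaceIndex_of_notMem h.symm fun hl => hL _ hl ⟨_, rfl⟩]

theorem overlap_det (k l : Fin N → Fin K) :
    overlap (FCISpace.det B k) (FCISpace.det B l) = (Nat.factorial N : ℂ)⁻¹ *
      ∑ π : Equiv.Perm (Fin N), ∑ ρ : Equiv.Perm (Fin N),
        ((Equiv.Perm.sign π : ℤ) : ℂ) * ((Equiv.Perm.sign ρ : ℤ) : ℂ) *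
          if k ∘ π.symm = l ∘ ρ.symm then 1 else 0 := inner_slater B k l

/-- The `L²`-adjoint of a substitution operator is the inverse substitution. -/
theorem overlap_substitutionOp {I L : Finset (Fin K)} (h : I.card = L.card) (hd : Disjoint I L)
    (u v : FCISpace N B) : overlap (substitutionOp N B L I h.symm u) v =
      overlap u (substitutionOp N B I L h v) := by
  classical
  refine FCISpace.det_induction (p := fun u => overlap (substitutionOp N B L I h.symm u) v =
      overlap u (substitutionOp N B I L h v)) (fun ν hν => ?_)
    (by rw [map_zero, overlap_zero_left, overlap_zero_left])
    (fun u u' hu hu' => by rw [map_add, overlap_add_left, overlap_add_left, hu, hu'])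
    (fun c u hu => by rw [map_smul, overlap_smul_left, overlap_smul_left, hu]) u
  refine FCISpace.det_induction (p := fun v => overlap (substitutionOp N B L I h.symm
      (FCISpace.det B ν)) v = overlap (FCISpace.det B ν) (substitutionOp N B I L h v))
    (fun κ hκ => ?_) (by rw [map_zero, overlap_zero_right, overlap_zero_right])
    (fun u u' hu hu' => by rw [map_add, overlap_add_right, overlap_add_right, hu, hu'])
    (fun c u hu => by rw [map_smul, overlap_smul_right, overlap_smul_right, hu]) v
  rw [substitutionOp_det _ _ _ _ _ hν, substitutionOp_det _ _ _ _ _ hκ]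
  by_cases h1 : (∀ l ∈ L, l ∈ Set.range ν) ∧ ∀ i ∈ I, i ∉ Set.range ν <;>
    by_cases h2 : (∀ i ∈ I, i ∈ Set.range κ) ∧ ∀ l ∈ L, l ∉ Set.range κ
  · rw [if_pos h1, if_pos h2, overlap_det, overlap_det]
    congr 1
    refine Finset.sum_congr rfl fun π _ => Finset.sum_congr rfl fun ρ _ => ?_
    congr 1
    refine if_congr ⟨fun he => ?_, fun he => ?_⟩ rfl rfl
    · exact (substitution_transpose h.symm hd.symm π.symm ρ.symm h1.1 h1.2 he).2
    · exact (substitution_transpose h hd ρ.symm π.symm h2.1 h2.2 he.symm).2.symm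
  -- If only one side survives the occupancy test, its overlap must still vanish: any matching of
  -- tuples would force the other test to succeed.
  · rw [if_pos h1, if_neg h2, overlap_det, overlap_zero_right]
    refine mul_eq_zero_of_right _ (Finset.sum_eq_zero fun π _ => Finset.sum_eq_zero fun ρ _ => ?_)
    rw [if_neg, mul_zero]
    exact fun he => h2 (substitution_transpose h.symm hd.symm π.symm ρ.symm h1.1 h1.2 he).1
  · rw [if_neg h1, if_pos h2, overlap_det, overlap_zero_left]
    refine (mul_eq_zero_of_right _
      (Finset.sum_eq_zero fun π _ => Finset.sum_eq_zero fun ρ _ => ?_)).symm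
    rw [if_neg, mul_zero]
    exact fun he => h1 (substitution_transpose h hd ρ.symm π.symm h2.1 h2.2 he.symm).1
  · rw [if_neg h1, if_neg h2, overlap_zero_left, overlap_zero_right]

theorem overlap_deexcitationOp (μ : ExcIndex N K) (u v : FCISpace N B) :
    overlap (deexcitationOp B μ u) v = overlap u (excitationOp B μ v) :=
  overlap_substitutionOp μ.card_eq
    (Finset.disjoint_left.2 fun _ hi hl => μ.vir_notMem_occ μ hl hi) u v

variable {h : N ≤ K}

theorem deexcitationOp_refDet (μ : ExcIndex N K) : deexcitationOp B μ (refDet B h) = 0 := by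
  classical
  refine (substitutionOp_det _ _ _ _ _ (Fin.strictMono_castLE h)).trans (if_neg fun hc => ?_)
  obtain ⟨l, hl⟩ : μ.vir.Nonempty := by
    rw [← Finset.card_pos, ← μ.card_eq, Finset.card_pos]; exact μ.2.2.2.1
  obtain ⟨p, rfl⟩ := hc.1 l hl
  exact absurd p.2 (not_lt.2 (μ.2.2.1 _ hl))

theorem overlap_refDet_excDet (μ : ExcIndex N K) : overlap (refDet B h) (excDet B h μ) = 0 := by
  rw [excDet, ← overlap_deexcitationOp, deexcitationOp_refDet, overlap_zero_left]

theorem overlap_basis (k l : OrderedIndex N K) [Decidable (k = l)] :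
    overlap (FCISpace.det B k.1) (FCISpace.det B l.1) = if k = l then 1 else 0 := by
  classical
  have := orthonormal_iff_ite.1 (orthonormal_slater B (fun k : OrderedIndex N K => k.1)
    (fun k => k.2.injective)
    (fun k l h => Subtype.ext ((StrictMono.range_inj k.2 l.2).1 h))) k l
  refine this.trans ?_
  congr

theorem overlap_refDet_refDet : overlap (refDet B h) (refDet B h) = 1 := by
  classical
  have := overlap_basis (B := B) ⟨Fin.castLE h, Fin.strictMono_castLE h⟩
    ⟨Fin.castLE h, Fin.strictMono_castLE h⟩
  rwa [if_pos rfl] at this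

/-- Every basis determinant other than the reference is, up to sign, an excited determinant: excite
from the reference orbitals missing in `ν` to the new ones in `ν`. The excited tuple takes its
values in the range of `ν`, so it is a permutation of `ν`. -/
theorem det_mem_excitedSubspace {ν : Fin N → Fin K} (hν : StrictMono ν) (hne : ν ≠ Fin.castLE h) :
    FCISpace.det B ν ∈ excitedSubspace B h := by
  classical
  set A : Finset (Fin K) := Finset.univ.image (Fin.castLE h) with hA
  set R : Finset (Fin K) := Finset.univ.image ν with hR
  have hcA : A.card = N := by
    rw [hA, Finset.card_image_of_injective _ (Fin.castLE_injective h)]; simp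
  have hcR : R.card = N := by
    rw [hR, Finset.card_image_of_injective _ hν.injective]; simp
  have hmA (p : Fin K) : p ∈ A ↔ (p : ℕ) < N := by
    simp only [hA, Finset.mem_image, Finset.mem_univ, true_and]
    exact ⟨fun ⟨q, hq⟩ => hq ▸ q.2, fun hp => ⟨⟨p, hp⟩, rfl⟩⟩
  -- Both sets have `N` elements, so inclusion would force equality, and a strictly increasing tuple
  -- is determined by its range.
  have hAR : (A \ R).Nonempty := by
    rw [Finset.sdiff_nonempty]
    intro hs
    have he := Finset.eq_of_subset_of_card_le hs (by rw [hcA, hcR])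
    refine hne ((StrictMono.range_inj hν (Fin.strictMono_castLE h)).1 ?_)
    have := congrArg (fun s : Finset (Fin K) => (s : Set (Fin K))) he
    simpa [hA, hR] using this.symm
  let μ : ExcIndex N K := ⟨(A \ R, R \ A), fun i hi => (hmA i).1 (Finset.mem_sdiff.1 hi).1,
    fun l hl => not_lt.1 fun hc => (Finset.mem_sdiff.1 hl).2 ((hmA l).2 hc), hAR,
    Finset.card_sdiff_comm (by rw [hcA, hcR])⟩
  have hsub (p : Fin N) : ∃ q, ν q = replaceIndex μ.occ μ.vir μ.card_eq (Fin.castLE h p) := by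
    have : replaceIndex μ.occ μ.vir μ.card_eq (Fin.castLE h p) ∈ R := by
      by_cases hp : Fin.castLE h p ∈ μ.occ
      · exact (Finset.mem_sdiff.1 (replaceIndex_mem μ.card_eq hp)).1
      · rw [replaceIndex_of_notMem _ hp]
        by_contra hc
        exact hp (Finset.mem_sdiff.2 ⟨(hmA _).2 p.2, hc⟩)
    simpa [hR] using this
  choose σ hσ using hsub
  have hσi : Function.Injective σ := fun p q hpq => μ.tuple_injective h (by
    rw [Function.comp_apply, Function.comp_apply, ← hσ, ← hσ, hpq])
  let τ : Equiv.Perm (Fin N) := Equiv.ofBijective σ (Finite.injective_iff_bijective.1 hσi)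
  have he : excDet B h μ = ((Equiv.Perm.sign τ : ℤ) : ℂ) • FCISpace.det B ν := by
    rw [excDet_eq, ← FCISpace.det_perm]
    congr 1
    funext p
    exact (hσ p).symm
  have h2 := Submodule.smul_mem (excitedSubspace B h) (((Equiv.Perm.sign τ : ℤ) : ℂ))
    (Submodule.subset_span ⟨μ, rfl⟩)
  rwa [he, smul_smul, ← Int.cast_mul, ← Units.val_mul, Int.units_mul_self, Units.val_one,
    Int.cast_one, one_smul] at h2

theorem overlap_refDet_of_mem {u : FCISpace N B} (hu : u ∈ excitedSubspace B h) :
    overlap (refDet B h) u = 0 := by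
  refine Submodule.span_induction ?_ (overlap_zero_right _)
    (fun u v _ _ hu hv => by rw [overlap_add_right, hu, hv, add_zero])
    (fun c u _ hu => by rw [overlap_smul_right, hu, mul_zero]) hu
  rintro _ ⟨μ, rfl⟩
  exact overlap_refDet_excDet μ

theorem sub_overlap_smul_mem (u : FCISpace N B) :
    u - overlap (refDet B h) u • refDet B h ∈ excitedSubspace B h := by
  refine FCISpace.det_induction (p := fun u =>
    u - overlap (refDet B h) u • refDet B h ∈ excitedSubspace B h) (fun ν hν => ?_) ?_ ?_ ?_ u
  · by_cases hne : ν = Fin.castLE h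
    · subst hne
      have h1 : overlap (refDet B h) (FCISpace.det B (Fin.castLE h)) = 1 := overlap_refDet_refDet
      rw [h1, one_smul]
      exact (sub_self (refDet B h)).symm ▸ Submodule.zero_mem _
    · have hm := det_mem_excitedSubspace (B := B) hν hne
      rwa [overlap_refDet_of_mem hm, zero_smul, sub_zero]
  · rw [overlap_zero_right, zero_smul, sub_zero]; exact Submodule.zero_mem _
  · intro u v hu hv
    rw [overlap_add_right, add_smul, add_sub_add_comm]
    exact Submodule.add_mem _ hu hv
  · intro c u hu
    rw [overlap_smul_right, mul_smul, ← smul_sub]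
    exact Submodule.smul_mem _ _ hu

/-- This turns orthogonality to `Ψ₀` into having a coefficient vector, as needed to convert test
vectors in the inf-sup estimate. -/
theorem mem_excitedSubspace_iff {u : FCISpace N B} :
    u ∈ excitedSubspace B h ↔ overlap (refDet B h) u = 0 := by
  refine ⟨overlap_refDet_of_mem, fun hu => ?_⟩
  have := sub_overlap_smul_mem (h := h) u
  rwa [hu, zero_smul, sub_zero] at this

open scoped Classical in
/-- The coefficient vector of `Ψ_μ`. -/
def CoeffSpace.single (μ : ExcIndex N K) : CoeffSpace B h := (Pi.single μ 1 : ExcIndex N K → ℂ)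

open scoped Classical in
theorem CoeffSpace.coord_single (μ ν : ExcIndex N K) :
    CoeffSpace.coord ν (CoeffSpace.single μ : CoeffSpace B h) = if ν = μ then 1 else 0 :=
  Pi.single_apply μ (1 : ℂ) ν

theorem CoeffSpace.expand_single (μ : ExcIndex N K) :
    CoeffSpace.expand (CoeffSpace.single μ : CoeffSpace B h) = excDet B h μ := by
  rw [CoeffSpace.expand_apply, Finset.sum_eq_single μ]
  · rw [CoeffSpace.coord_single, if_pos rfl, one_smul]
  · intro ν _ hν
    rw [CoeffSpace.coord_single, if_neg hν, zero_smul]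
  · exact fun hc => absurd (Finset.mem_univ μ) hc

theorem excitedSubspace_eq_range :
    excitedSubspace B h = LinearMap.range (CoeffSpace.expand : CoeffSpace B h →ₗ[ℂ] _) := by
  refine le_antisymm (Submodule.span_le.2 ?_) ?_
  · rintro _ ⟨μ, rfl⟩
    exact ⟨CoeffSpace.single μ, CoeffSpace.expand_single μ⟩
  · rintro _ ⟨t, rfl⟩
    rw [CoeffSpace.expand_apply]
    exact Submodule.sum_mem _ fun μ _ => Submodule.smul_mem _ _ (Submodule.subset_span ⟨μ, rfl⟩)

end

/-! ### A quantitative inverse function theorem. -/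

section

section
variable {V W : Type*} [NormedAddCommGroup V] [NormedSpace ℂ V] [NormedAddCommGroup W]
  [NormedSpace ℂ W] {f : V → W} {x₀ : V} {l δ : ℝ}

/-- Integration of the derivative along the segment from `x₀` to `s`. The factor `1/2`, coming from
`∫ τ dτ`, is what makes the constants 2 in the final estimate come out on the whole ball. -/
theorem norm_sub_sub_fderiv_le (hf : Differentiable ℂ f)
    (hl : ∀ y ∈ Metric.ball x₀ δ, ‖fderiv ℂ f y - fderiv ℂ f x₀‖ ≤ l * ‖y - x₀‖)
    {s : V} (hs : s ∈ Metric.ball x₀ δ) :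
    ‖f s - f x₀ - fderiv ℂ f x₀ (s - x₀)‖ ≤ l / 2 * ‖s - x₀‖ ^ 2 := by
  set v := s - x₀ with hv
  have hr : ‖v‖ < δ := by rwa [Metric.mem_ball, dist_eq_norm] at hs
  have hd (τ : ℝ) : HasDerivAt (fun τ : ℝ => f (x₀ + τ • v) - f x₀ - τ • fderiv ℂ f x₀ v)
      (fderiv ℂ f (x₀ + τ • v) v - fderiv ℂ f x₀ v) τ := by
    have h1 : HasDerivAt (fun τ : ℝ => x₀ + τ • v) v τ := by
      simpa using! ((hasDerivAt_id τ).smul_const v).const_add x₀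
    have h2 := ((hf (x₀ + τ • v)).hasFDerivAt.restrictScalars ℝ).comp_hasDerivAt τ h1
    have h3 : HasDerivAt (fun τ : ℝ => τ • fderiv ℂ f x₀ v) (fderiv ℂ f x₀ v) τ := by
      simpa using! (hasDerivAt_id τ).smul_const (fderiv ℂ f x₀ v)
    exact (h2.sub_const _).sub h3
  have key := image_norm_le_of_norm_deriv_right_le_deriv_boundary (a := 0) (b := 1)
    (fun τ _ => (hd τ).continuousAt.continuousWithinAt) (fun τ _ => (hd τ).hasDerivWithinAt)
    (B := fun τ => l / 2 * ‖v‖ ^ 2 * τ ^ 2) (B' := fun τ => l * ‖v‖ ^ 2 * τ) (by simp)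
    (fun τ => by
      have := (hasDerivAt_pow 2 τ).const_mul (l / 2 * ‖v‖ ^ 2)
      refine this.congr_deriv ?_
      simp; ring)
    (fun τ hτ => by
      have hn : ‖x₀ + τ • v - x₀‖ = τ * ‖v‖ := by
        rw [add_sub_cancel_left, norm_smul, Real.norm_of_nonneg hτ.1]
      have hm : x₀ + τ • v ∈ Metric.ball x₀ δ := by
        rw [Metric.mem_ball, dist_eq_norm, hn]
        exact (mul_le_of_le_one_left (norm_nonneg _) hτ.2.le).trans_lt hr
      have h1 := hl _ hm
      rw [hn] at h1
      rw [← sub_apply]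
      refine (ContinuousLinearMap.le_opNorm _ _).trans
        ((mul_le_mul_of_nonneg_right h1 (norm_nonneg _)).trans (le_of_eq ?_))
      ring)
    (Set.right_mem_Icc.2 zero_le_one)
  simpa [hv] using! key

/-- The two-point version used for injectivity: on the closed ball of radius `r` the map `f -
Df(x₀)` has Lipschitz constant `l * r`. -/
theorem norm_image_sub_sub_fderiv_le (hf : Differentiable ℂ f) (hl0 : 0 ≤ l)
    (hl : ∀ y ∈ Metric.ball x₀ δ, ‖fderiv ℂ f y - fderiv ℂ f x₀‖ ≤ l * ‖y - x₀‖)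
    {r : ℝ} (hr : r < δ) {s s' : V} (hs : ‖s - x₀‖ ≤ r) (hs' : ‖s' - x₀‖ ≤ r) :
    ‖f s - f s' - fderiv ℂ f x₀ (s - s')‖ ≤ l * r * ‖s - s'‖ := by
  refine (convex_closedBall x₀ r).norm_image_sub_le_of_norm_hasFDerivWithin_le'
    (fun x _ => (hf x).hasFDerivAt.hasFDerivWithinAt) (fun x hx => ?_)
    (mem_closedBall_iff_norm.2 hs') (mem_closedBall_iff_norm.2 hs)
  have hx := mem_closedBall_iff_norm.1 hx
  exact (hl x (mem_ball_iff_norm.2 (hx.trans_lt hr))).trans (mul_le_mul_of_nonneg_left hx hl0)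

/-- A smooth map between spaces of the same finite dimension is a diffeomorphism from an open set onto
an open set if its derivative varies little enough compared with a lower bound at one point. -/
theorem isOpen_image_and_isDiffeoOn [FiniteDimensional ℂ V] [FiniteDimensional ℂ W]
    (hdim : Module.finrank ℂ V = Module.finrank ℂ W) (hf : ContDiff ℂ ∞ f) {c : ℝ}
    (hc : ∀ w, c * ‖w‖ ≤ ‖fderiv ℂ f x₀ w‖) {U : Set V} (hUo : IsOpen U)
    -- The constants may depend on the pair: the radius is a supremum over `δ` that need not be
    -- attained, so no single `δ` is available for the whole ball.
    (hU : ∀ s ∈ U, ∀ s' ∈ U, ∃ δ l r : ℝ, 0 ≤ l ∧ r < δ ∧ l * r < c ∧ ‖s - x₀‖ ≤ r ∧ ‖s' - x₀‖ ≤ r ∧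
      ∀ y ∈ Metric.ball x₀ δ, ‖fderiv ℂ f y - fderiv ℂ f x₀‖ ≤ l * ‖y - x₀‖) :
    IsOpen (f '' U) ∧ IsDiffeoOn f U := by
  have : CompleteSpace V := FiniteDimensional.complete ℂ V
  have : CompleteSpace W := FiniteDimensional.complete ℂ W
  have hfd : Differentiable ℂ f := hf.differentiable (by simp)
  have hinj : Set.InjOn f U := by
    intro s hs s' hs' he
    obtain ⟨δ, l, r, hl0, hr, hlc, h1, h2, hl⟩ := hU s hs s' hs'
    have h3 := norm_image_sub_sub_fderiv_le hfd hl0 hl hr h1 h2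
    rw [he, sub_self, zero_sub, norm_neg] at h3
    have h4 := (hc (s - s')).trans h3
    by_contra hne
    have : 0 < ‖s - s'‖ := norm_pos_iff.2 (sub_ne_zero.2 hne)
    exact absurd h4 (not_le.2 (mul_lt_mul_of_pos_right hlc this))
  -- At each point the derivative differs from the one at `x₀` by at most `l * r < c`, so it stays
  -- injective, and equality of dimensions makes it invertible.
  have hequiv (s : V) (hs : s ∈ U) : ∃ e : V ≃L[ℂ] W, HasFDerivAt f (e : V →L[ℂ] W) s := by
    obtain ⟨δ, l, r, hl0, hr, hlc, h1, -, hl⟩ := hU s hs s hs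
    have h2 := (hl s (mem_ball_iff_norm.2 (h1.trans_lt hr))).trans
      (mul_le_mul_of_nonneg_left h1 hl0)
    have hi : Function.Injective (fderiv ℂ f s : V →ₗ[ℂ] W) := by
      rw [injective_iff_map_eq_zero]
      intro w hw
      replace hw : fderiv ℂ f s w = 0 := hw
      by_contra hne
      have hpos : 0 < ‖w‖ := norm_pos_iff.2 hne
      have h3 := ContinuousLinearMap.le_of_opNorm_le _ h2 w
      rw [sub_apply, hw, zero_sub, norm_neg] at h3
      exact absurd ((hc w).trans h3) (not_le.2 (mul_lt_mul_of_pos_right hlc hpos))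
    have hb : Function.Bijective (fderiv ℂ f s : V →ₗ[ℂ] W) :=
      ⟨hi, (LinearMap.injective_iff_surjective_of_finrank_eq_finrank hdim).1 hi⟩
    refine ⟨(LinearEquiv.ofBijective _ hb).toContinuousLinearEquiv, ?_⟩
    convert (hfd s).hasFDerivAt using 1
    ext w
    rfl
  have hopen (U' : Set V) (hU' : U' ⊆ U) (ho : IsOpen U') : IsOpen (f '' U') := by
    rw [isOpen_iff_mem_nhds]
    rintro _ ⟨s, hs, rfl⟩
    obtain ⟨e, he⟩ := hequiv s (hU' hs)
    rw [← (hf.contDiffAt.hasStrictFDerivAt' he (by simp)).map_nhds_eq_of_equiv]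
    exact Filter.image_mem_map (ho.mem_nhds hs)
  refine ⟨hopen U subset_rfl hUo, hf.contDiffOn, hinj, Function.invFunOn f U,
    fun x hx => hinj.leftInvOn_invFunOn hx, ?_⟩
  rintro _ ⟨s, hs, rfl⟩
  obtain ⟨e, he⟩ := hequiv s hs
  refine ContDiffAt.contDiffWithinAt ?_
  have hfs : ContDiffAt ℂ ∞ f s := hf.contDiffAt
  refine (hfs.to_localInverse he (by simp)).congr_of_eventuallyEq ?_
  have hst := hfs.hasStrictFDerivAt' he (by simp)
  -- Near `f s` the smooth local inverse takes values in `U`, where `f` is injective, so it agrees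
  -- there with the global inverse.
  have h1 : ∀ᶠ y in nhds (f s), hst.localInverse f e s y ∈ U :=
    hst.localInverse_tendsto.eventually (hUo.mem_nhds hs)
  filter_upwards [h1, hst.eventually_right_inverse] with y hy hy'
  have h2 := hinj.leftInvOn_invFunOn hy
  rw [hy'] at h2
  exact h2

/-- A map with continuous second derivative has a derivative that is Lipschitz on balls. -/
theorem exists_norm_fderiv_sub_le [FiniteDimensional ℂ V] (hf : ContDiff ℂ ∞ f) (x₀ : V) (δ : ℝ) :
    ∃ l : ℝ, 0 ≤ l ∧
      ∀ y ∈ Metric.ball x₀ δ, ‖fderiv ℂ f x₀ - fderiv ℂ f y‖ ≤ l * ‖x₀ - y‖ := by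
  have : ProperSpace V := FiniteDimensional.proper ℂ V
  have h1 : ContDiff ℂ 1 (fderiv ℂ f) := hf.fderiv_right (by norm_cast)
  obtain ⟨C, hC⟩ := (isCompact_closedBall x₀ δ).exists_bound_of_continuousOn
    (h1.continuous_fderiv one_ne_zero).continuousOn
  -- For negative `δ` the closed ball is empty and `C` may be negative.
  refine ⟨max C 0, le_max_right _ _, fun y hy => ?_⟩
  refine (convex_closedBall x₀ δ).norm_image_sub_le_of_norm_hasFDerivWithin_le
    (fun x _ => ((h1.differentiable one_ne_zero) x).hasFDerivAt.hasFDerivWithinAt)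
    (fun x hx => (hC x hx).trans (le_max_left _ _)) (Metric.ball_subset_closedBall hy)
    (Metric.mem_closedBall_self (dist_nonneg.trans (Metric.mem_ball.1 hy).le))

end

end

/-! ### Operator form, smoothness and derivative of the coupled cluster function. -/

section

variable {N K : ℕ} {B : SingleParticleBasis K} {h : N ≤ K}

theorem SobolevH1.norm_toL2_le {X ι : Type*} [NormedAddCommGroup X] [NormedSpace ℝ X]
    [MeasureSpace X] [BorelSpace X] [IsFiniteMeasureOnCompacts (volume : Measure X)] [Fintype ι]
    {b : ι → X} (u : SobolevH1 b) : ‖u.toL2‖ ≤ ‖u‖ := by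
  have h1 := congrArg Complex.re (SobolevH1.inner_def u u)
  simp only [inner_self_eq_norm_sq_to_K, Complex.add_re, Complex.re_sum, ← Complex.ofReal_pow,
    Complex.coe_algebraMap, Complex.ofReal_re] at h1
  have h2 : 0 ≤ ∑ i, ‖u.grad i‖ ^ 2 := by positivity
  exact le_of_sq_le_sq (by linarith) (norm_nonneg _)

theorem norm_overlap_le (u v : FCISpace N B) : ‖overlap u v‖ ≤ ‖u‖ * ‖v‖ :=
  (norm_inner_le_norm _ _).trans (mul_le_mul (SobolevH1.norm_toL2_le u.toH1)
    (SobolevH1.norm_toL2_le v.toH1) (norm_nonneg _) (norm_nonneg _))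

theorem overlap_self (u : FCISpace N B) : overlap u u = ((‖u.toH1.toL2‖ ^ 2 : ℝ) : ℂ) := by
  rw [overlap, l2inner, inner_self_eq_norm_sq_to_K]
  norm_cast

/-- The norm of the space is that of `H¹`, but adjoints are taken in `L²`. Injectivity makes the
overlap a definite inner product, so vectors can be identified by their overlaps. -/
theorem FCISpace.toL2_injective :
    LinearMap.ker (SobolevH1.toL2 ∘ₗ (FCISpace.toH1 : FCISpace N B →ₗ[ℂ] ManyH1 N)) = ⊥ := by
  rw [LinearMap.ker_eq_bot']
  intro u hu
  replace hu : u.toH1.toL2 = 0 := hu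
  have h0 (v : FCISpace N B) : overlap v u = 0 := by
    rw [overlap, l2inner, hu, inner_zero_right]
  classical
  have h1 := (FCISpace.basis N B).sum_repr u
  have h2 (k : OrderedIndex N K) : (FCISpace.basis N B).repr u k = 0 := by
    have h3 := h0 (FCISpace.det B k.1)
    rw [← h1, overlap_sum_right] at h3
    simpa [FCISpace.basis_apply, overlap_smul_right, overlap_basis] using h3
  rw [← h1]
  simp [h2]

theorem eq_zero_of_overlap_self {u : FCISpace N B} (hu : overlap u u = 0) : u = 0 := by
  refine LinearMap.ker_eq_bot'.1 (FCISpace.toL2_injective (N := N) (B := B)) u ?_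
  rw [overlap, l2inner, inner_self_eq_zero] at hu
  exact hu

theorem ext_overlap {u v : FCISpace N B} (huv : ∀ w, overlap w u = overlap w v) : u = v := by
  rw [← sub_eq_zero]
  refine eq_zero_of_overlap_self ?_
  rw [overlap_sub_right, huv, sub_self]

/-- The energy form as a functional of its second argument. -/
def energyRight (mol : Molecule) (u : FCISpace N B) : FCISpace N B →ₗ[ℂ] ℂ where
  toFun v := mol.energyForm u.toH1 v.toH1
  map_add' v w := by
    rw [map_add]
    exact Molecule.energyForm_add_right (u.toH1_mem_finitePotential B mol)
      (v.toH1_mem_finitePotential B mol) (w.toH1_mem_finitePotential B mol)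
  map_smul' c v := by
    rw [map_smul]
    exact Molecule.energyForm_smul_right mol _ _ c

/-- The Full-CI Hamiltonian as an operator. -/
def hamiltonianOp (mol : Molecule) : FCISpace N B →L[ℂ] FCISpace N B :=
  -- The determinants form an `L²`-orthonormal basis, so the values of the form on them are the
  -- coordinates of `H v`.
  LinearMap.toContinuousLinearMap (∑ k : OrderedIndex N K,
    (energyRight mol (FCISpace.det B k.1)).smulRight (FCISpace.det B k.1))

theorem overlap_hamiltonianOp (mol : Molecule) (u v : FCISpace N B) :
    overlap u (hamiltonianOp mol v) = mol.energyForm u.toH1 v.toH1 := by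
  classical
  -- Linearity is available in the second argument, and hermitian symmetry transfers it to the
  -- first.
  have hr (u v : FCISpace N B) : mol.energyForm u.toH1 v.toH1 = conj (energyRight mol v u) :=
    (mol.energyForm_conj _ _).symm
  refine FCISpace.det_induction (p := fun u => overlap u (hamiltonianOp mol v) =
    mol.energyForm u.toH1 v.toH1) (fun ν hν => ?_) ?_ ?_ ?_ u
  · have h1 : hamiltonianOp mol v = ∑ k : OrderedIndex N K,
        mol.energyForm (FCISpace.det B k.1).toH1 v.toH1 • FCISpace.det B k.1 := by
      simp [hamiltonianOp, energyRight]
    rw [h1, overlap_sum_right, Finset.sum_eq_single ⟨ν, hν⟩]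
    · have h2 := overlap_basis (B := B) ⟨ν, hν⟩ ⟨ν, hν⟩
      rw [if_pos rfl] at h2
      rw [overlap_smul_right, h2, mul_one]
    · intro k _ hk
      have h2 := overlap_basis (B := B) ⟨ν, hν⟩ k
      rw [if_neg hk.symm] at h2
      rw [overlap_smul_right, h2, mul_zero]
    · exact fun hc => absurd (Finset.mem_univ _) hc
  · rw [overlap_zero_left, hr, map_zero, map_zero]
  · intro u u' hu hu'
    rw [overlap_add_left, hu, hu', hr, hr, hr, map_add, map_add]
  · intro c u hu
    rw [overlap_smul_left, hu, hr, hr, map_smul, smul_eq_mul, map_mul]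

/-- `H - E` as an operator. -/
def shiftedOp (mol : Molecule) (E : ℝ) : FCISpace N B →L[ℂ] FCISpace N B :=
  hamiltonianOp mol - (E : ℂ) • 1

theorem overlap_shiftedOp (mol : Molecule) (E : ℝ) (u v : FCISpace N B) :
    overlap u (shiftedOp mol E v) = shiftedForm mol E u v := by
  rw [shiftedOp, sub_apply, smul_apply, one_apply_eq_self,
    overlap_sub_right, overlap_smul_right, overlap_hamiltonianOp, shiftedForm]

theorem conj_shiftedForm (mol : Molecule) (E : ℝ) (u v : FCISpace N B) :
    conj (shiftedForm mol E u v) = shiftedForm mol E v u := by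
  rw [shiftedForm, map_sub, mol.energyForm_conj, map_mul, Complex.conj_ofReal, conj_overlap,
    shiftedForm]

theorem IsEigenfunction.hamiltonianOp_apply {mol : Molecule} {E : ℝ} {Ψ : FCISpace N B}
    (hΨ : IsEigenfunction mol E Ψ) : hamiltonianOp mol Ψ = (E : ℂ) • Ψ :=
  ext_overlap fun w => by rw [overlap_hamiltonianOp, hΨ.2, overlap_smul_right]

theorem IsEigenfunction.shiftedOp_apply {mol : Molecule} {E : ℝ} {Ψ : FCISpace N B}
    (hΨ : IsEigenfunction mol E Ψ) : shiftedOp mol E Ψ = 0 := by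
  rw [shiftedOp, sub_apply, hΨ.hamiltonianOp_apply]
  simp

theorem commute_clusterOp (s t : CoeffSpace B h) : Commute (clusterOp s) (clusterOp t) := by
  refine Commute.sum_left _ _ _ fun μ _ => Commute.sum_right _ _ _ fun ν _ =>
    Commute.smul_left (Commute.smul_right ?_ _) _
  exact ContinuousLinearMap.ext fun u => excitationOp_comm μ ν u

theorem clusterOp_refDet (t : CoeffSpace B h) :
    clusterOp t (refDet B h) = CoeffSpace.expand t := by
  rw [CoeffSpace.expand_apply]
  simp [clusterOp, excDet]

theorem overlap_clusterAdj (t : CoeffSpace B h) (u v : FCISpace N B) :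
    overlap (clusterAdj t u) v = overlap u (clusterOp t v) := by
  simp only [clusterAdj, clusterOp, sum_apply, smul_apply,
    LinearMap.coe_toContinuousLinearMap', overlap_sum_left, overlap_sum_right, overlap_smul_left,
    overlap_smul_right, Complex.conj_conj, overlap_deexcitationOp]

theorem exp_add_of_commute_op {S T : FCISpace N B →L[ℂ] FCISpace N B} (hST : Commute S T) :
    NormedSpace.exp (S + T) = NormedSpace.exp S * NormedSpace.exp T := by
  let _ := NormedAlgebra.restrictScalars ℚ ℂ (FCISpace N B →L[ℂ] FCISpace N B)
  exact NormedSpace.exp_add_of_commute hST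

theorem exp_neg_mul_exp (T : FCISpace N B →L[ℂ] FCISpace N B) :
    NormedSpace.exp (-T) * NormedSpace.exp T = 1 := by
  rw [← exp_add_of_commute_op (Commute.neg_left (Commute.refl T)), neg_add_cancel,
    NormedSpace.exp_zero]

theorem exp_neg_exp_apply (T : FCISpace N B →L[ℂ] FCISpace N B) (u : FCISpace N B) :
    NormedSpace.exp (-T) (NormedSpace.exp T u) = u :=
  DFunLike.congr_fun (exp_neg_mul_exp T) u

/-- Adjointness passes to powers and then, by continuity of the overlap in finite dimension, to the
exponential series. -/
theorem overlap_exp {S T : FCISpace N B →L[ℂ] FCISpace N B}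
    (hST : ∀ u v, overlap (S u) v = overlap u (T v)) (u v : FCISpace N B) :
    overlap (NormedSpace.exp S u) v = overlap u (NormedSpace.exp T v) := by
  have hpow (n : ℕ) : ∀ u v, overlap ((S ^ n) u) v = overlap u ((T ^ n) v) := by
    induction n with
    | zero => intro u v; rfl
    | succ n ih =>
      intro u v
      rw [pow_succ, pow_succ', mul_apply_eq_comp, mul_apply_eq_comp,
        ih, hST]
  let R (u : FCISpace N B) : FCISpace N B →L[ℂ] ℂ := LinearMap.toContinuousLinearMap (overlapRight u)
  have h1 := ((NormedSpace.exp_series_hasSum_exp' (𝕂 := ℂ) T).mapL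
    (ContinuousLinearMap.apply ℂ (FCISpace N B) v)).mapL (R u)
  have h2 := (((NormedSpace.exp_series_hasSum_exp' (𝕂 := ℂ) S).mapL
    (ContinuousLinearMap.apply ℂ (FCISpace N B) u)).mapL (R v)).map (starRingEnd ℂ)
    Complex.continuous_conj
  have h3 : overlap (NormedSpace.exp S u) v = conj (R v (NormedSpace.exp S u)) :=
    (conj_overlap _ _).symm
  rw [h3]
  refine h2.unique ?_
  convert! h1 using 1
  refine funext fun n => Eq.symm ?_
  change overlap u (((n.factorial : ℂ)⁻¹ • T ^ n) v) =
    conj (overlap v (((n.factorial : ℂ)⁻¹ • S ^ n) u))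
  rw [conj_overlap, smul_apply, smul_apply, overlap_smul_left, overlap_smul_right, hpow]
  simp

theorem overlap_exp_clusterAdj (t : CoeffSpace B h) (u v : FCISpace N B) :
    overlap (NormedSpace.exp (clusterAdj t) u) v = overlap u (NormedSpace.exp (clusterOp t) v) :=
  overlap_exp (overlap_clusterAdj t) u v

theorem overlap_exp_neg_clusterAdj (t : CoeffSpace B h) (u v : FCISpace N B) :
    overlap (NormedSpace.exp (-clusterAdj t) u) v =
      overlap u (NormedSpace.exp (-clusterOp t) v) := by
  refine overlap_exp (fun u v => ?_) u v
  rw [neg_apply, neg_apply, ← neg_one_smul ℂ, ← neg_one_smul ℂ (clusterOp t v), overlap_smul_left,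
    overlap_smul_right, overlap_clusterAdj]
  simp

/-- The cluster operator as a linear function of the coefficients. -/
def clusterOpL : CoeffSpace B h →L[ℂ] FCISpace N B →L[ℂ] FCISpace N B :=
  LinearMap.toContinuousLinearMap (∑ μ, (CoeffSpace.coord μ).smulRight
    (LinearMap.toContinuousLinearMap (excitationOp B μ)))

theorem clusterOpL_apply (t : CoeffSpace B h) : clusterOpL t = clusterOp t := by
  simp [clusterOpL, clusterOp]

/-- The functional `s ↦ (∑ μ, s_μ Ψ_μ, u)`. -/
def dualOf (B : SingleParticleBasis K) (h : N ≤ K) : FCISpace N B →L[ℂ] AntiDual B h :=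
  LinearMap.toContinuousLinearMap (∑ μ, (overlapRight (excDet B h μ)).smulRight
    (((starL ℂ : ℂ ≃L⋆[ℂ] ℂ) : ℂ →L⋆[ℂ] ℂ).comp
      (LinearMap.toContinuousLinearMap (CoeffSpace.coord μ))))

theorem dualOf_apply (u : FCISpace N B) (s : CoeffSpace B h) :
    dualOf B h u s = overlap (CoeffSpace.expand s) u := by
  rw [CoeffSpace.expand_apply, overlap_sum_left]
  simp [dualOf, overlapRight, overlap_smul_left, mul_comm]

/-- Moving `e^{-T†}` across the overlap expresses `f` through continuous linear maps and operator
exponentials, from which smoothness and the derivative can be read off. -/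
theorem ccFunction_eq (mol : Molecule) (t : CoeffSpace B h) :
    ccFunction mol t = dualOf B h (NormedSpace.exp (-clusterOp t)
      (hamiltonianOp mol (NormedSpace.exp (clusterOp t) (refDet B h)))) := by
  ext s
  rw [dualOf_apply, ccFunction_apply, CoeffSpace.expand_apply, overlap_sum_left]
  refine Finset.sum_congr rfl fun μ _ => ?_
  rw [overlap_smul_left, ccComponent, ccForm, ← overlap_hamiltonianOp, overlap_exp_neg_clusterAdj]

theorem contDiff_exp {n : WithTop ℕ∞} :
    ContDiff ℂ n (NormedSpace.exp : (FCISpace N B →L[ℂ] FCISpace N B) → _) :=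
  AnalyticOnNhd.contDiff fun x _ => NormedSpace.exp_analytic x

theorem contDiff_ccFunction (mol : Molecule) :
    ContDiff ℂ ∞ (ccFunction mol : CoeffSpace B h → AntiDual B h) := by
  have he : (ccFunction mol : CoeffSpace B h → AntiDual B h) = fun t =>
      dualOf B h (NormedSpace.exp (-clusterOpL t)
        (hamiltonianOp mol (NormedSpace.exp (clusterOpL t) (refDet B h)))) := by
    funext t
    rw [ccFunction_eq, clusterOpL_apply]
  rw [he]
  have h1 : ContDiff ℂ ∞ fun t : CoeffSpace B h => NormedSpace.exp (clusterOpL t) :=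
    contDiff_exp.comp clusterOpL.contDiff
  have h2 : ContDiff ℂ ∞ fun t : CoeffSpace B h => NormedSpace.exp (-clusterOpL t) :=
    contDiff_exp.comp clusterOpL.contDiff.neg
  exact (dualOf B h).contDiff.comp
    (h2.clm_apply ((hamiltonianOp mol).contDiff.comp (h1.clm_apply contDiff_const)))

/-- The similarity-transformed Hamiltonian `e^{-T} H e^{T}`. -/
def similarityOp (mol : Molecule) (t : CoeffSpace B h) : FCISpace N B →L[ℂ] FCISpace N B :=
  NormedSpace.exp (-clusterOp t) * hamiltonianOp mol * NormedSpace.exp (clusterOp t)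

/-- Cluster operators commute, so `e^{T + W} = e^{T} e^{W}` and the factors in `T` are absorbed into
the Hamiltonian. Differentiation at `t` is thereby reduced to differentiation at `0`, where the
exponential has derivative the identity. -/
theorem ccFunction_add (mol : Molecule) (t w : CoeffSpace B h) :
    ccFunction mol (t + w) = dualOf B h (NormedSpace.exp (-clusterOpL w)
      (similarityOp mol t (NormedSpace.exp (clusterOpL w) (refDet B h)))) := by
  have h1 : clusterOp (t + w) = clusterOp t + clusterOp w := by
    simp only [← clusterOpL_apply, map_add]
  rw [ccFunction_eq, h1, exp_add_of_commute_op (commute_clusterOp t w), neg_add_rev,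
    exp_add_of_commute_op (commute_clusterOp w t).neg_left.neg_right, clusterOpL_apply]
  rfl

/-- The product rule at `w = 0` leaves the commutator of the transformed Hamiltonian with the
cluster operator of `w`, applied to `Ψ₀`. -/
theorem fderiv_ccFunction_apply (mol : Molecule) (t w : CoeffSpace B h) :
    fderiv ℂ (ccFunction mol) t w = dualOf B h
      (similarityOp mol t (clusterOp w (refDet B h)) - clusterOp w (similarityOp mol t (refDet B h))) := by
  set X := similarityOp mol t
  have e0 : HasFDerivAt (NormedSpace.exp : (FCISpace N B →L[ℂ] FCISpace N B) → _)
      (1 : (FCISpace N B →L[ℂ] FCISpace N B) →L[ℂ] _)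
      ((clusterOpL : CoeffSpace B h →L[ℂ] _) 0) := by
    rw [map_zero]; exact hasFDerivAt_exp_zero
  have e0' : HasFDerivAt (NormedSpace.exp : (FCISpace N B →L[ℂ] FCISpace N B) → _)
      (1 : (FCISpace N B →L[ℂ] FCISpace N B) →L[ℂ] _)
      ((-clusterOpL : CoeffSpace B h →L[ℂ] _) 0) := by
    rw [map_zero]; exact hasFDerivAt_exp_zero
  have h1 := e0.comp (0 : CoeffSpace B h) clusterOpL.hasFDerivAt
  have h2 := e0'.comp (0 : CoeffSpace B h) (-clusterOpL).hasFDerivAt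
  have h3 := h2.clm_apply
    (X.hasFDerivAt.comp 0 (h1.clm_apply (hasFDerivAt_const (refDet B h) (0 : CoeffSpace B h))))
  have h4 := (dualOf B h).hasFDerivAt.comp 0 h3
  have h5 : HasFDerivAt (fun w => ccFunction mol (t + w)) _ 0 :=
    h4.congr_of_eventuallyEq (.of_forall fun w => ccFunction_add mol t w)
  have h6 : fderiv ℂ (ccFunction mol) t = fderiv ℂ (fun w => ccFunction mol (t + w)) 0 := by
    rw [fderiv_comp_add_left, add_zero]
  rw [h6, h5.fderiv]
  simp only [ContinuousLinearMap.comp_apply, add_apply, ContinuousLinearMap.flip_apply,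
    Function.comp_apply, map_zero, neg_apply, NormedSpace.exp_zero, one_apply_eq_self,
    zero_apply, zero_add, sub_eq_add_neg]
  simp only [clusterOpL_apply]

end

/-! ### The constants `γ`, `Θ`, `α`, `L(δ)`, `R` and the inf-sup estimate for the derivative. -/

section

variable {N K : ℕ} {B : SingleParticleBasis K} {h : N ≤ K} {mol : Molecule} {E : ℝ}
  {Ψ : FCISpace N B} {t : CoeffSpace B h}

theorem enorm_overlap_le (u v : FCISpace N B) : ‖overlap u v‖ₑ ≤ ‖u‖ₑ * ‖v‖ₑ := by
  rw [← ofReal_norm, ← ofReal_norm, ← ofReal_norm, ← ENNReal.ofReal_mul (norm_nonneg _)]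
  exact ENNReal.ofReal_le_ofReal (norm_overlap_le u v)

theorem enorm_overlap_apply_le (X : FCISpace N B →L[ℂ] FCISpace N B) (u v : FCISpace N B) :
    ‖overlap u (X v)‖ₑ ≤ ‖X‖ₑ * (‖u‖ₑ * ‖v‖ₑ) :=
  (enorm_overlap_le _ _).trans ((mul_le_mul_right (X.le_opENorm v) _).trans_eq (by ring))

/-- The similarity-transformed operator `e^{-T} (H - E) e^{T}`. -/
def shiftedSimilarityOp (mol : Molecule) (E : ℝ) (t : CoeffSpace B h) :
    FCISpace N B →L[ℂ] FCISpace N B :=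
  NormedSpace.exp (-clusterOp t) * shiftedOp mol E * NormedSpace.exp (clusterOp t)

theorem shiftedForm_exp (t : CoeffSpace B h) (u v : FCISpace N B) :
    shiftedForm mol E (NormedSpace.exp (-clusterAdj t) u) (NormedSpace.exp (clusterOp t) v) =
      overlap u (shiftedSimilarityOp mol E t v) := by
  rw [← overlap_shiftedOp, overlap_exp_neg_clusterAdj]
  rfl

theorem continuityConst_lt_top : continuityConst mol E t < ⊤ := by
  have hle : continuityConst mol E t ≤ ‖shiftedSimilarityOp mol E t‖ₑ := by
    refine iSup₂_le fun Φ _ => iSup₂_le fun Ψ _ => ENNReal.div_le_of_le_mul ?_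
    rw [shiftedForm_exp]
    exact enorm_overlap_apply_le _ _ _
  exact hle.trans_lt enorm_lt_top

theorem CoeffSpace.enorm_def (s : CoeffSpace B h) : ‖s‖ₑ = ‖CoeffSpace.expand s‖ₑ := by
  rw [← ofReal_norm, ← ofReal_norm, CoeffSpace.norm_def]

theorem expand_mem_excitedSubspace (s : CoeffSpace B h) :
    CoeffSpace.expand s ∈ excitedSubspace B h := by
  rw [excitedSubspace_eq_range]; exact ⟨s, rfl⟩

theorem enorm_shiftedForm_expand_le (s w : CoeffSpace B h) :
    ‖shiftedForm mol E (NormedSpace.exp (-clusterAdj t) (CoeffSpace.expand s))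
      (NormedSpace.exp (clusterOp t) (CoeffSpace.expand w))‖ₑ ≤
      continuityConst mol E t * (‖s‖ₑ * ‖w‖ₑ) := by
  by_cases hs : CoeffSpace.expand s = 0
  · rw [hs, map_zero, ← conj_shiftedForm, ← overlap_shiftedOp, map_zero, overlap_zero_right]
    simp
  by_cases hw : CoeffSpace.expand w = 0
  · rw [hw, map_zero, ← overlap_shiftedOp, map_zero, overlap_zero_right]
    simp
  rw [CoeffSpace.enorm_def, CoeffSpace.enorm_def]
  have h1 : ‖CoeffSpace.expand s‖ₑ * ‖CoeffSpace.expand w‖ₑ ≠ 0 :=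
    mul_ne_zero (enorm_ne_zero.2 hs) (enorm_ne_zero.2 hw)
  rw [← ENNReal.div_le_iff h1 (ENNReal.mul_ne_top enorm_ne_top enorm_ne_top)]
  exact le_iSup₂_of_le (CoeffSpace.expand s) ⟨expand_mem_excitedSubspace s, hs⟩
    (le_iSup₂_of_le (CoeffSpace.expand w) ⟨expand_mem_excitedSubspace w, hw⟩ le_rfl)

/-- The derivative of the coupled cluster function at the coefficients of an eigenfunction. -/
theorem fderiv_ccFunction_of_isEigenfunction (hΨ : IsEigenfunction mol E Ψ)
    (htΨ : NormedSpace.exp (clusterOp t) (refDet B h) = Ψ) (w s : CoeffSpace B h) :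
    fderiv ℂ (ccFunction mol) t w s =
      shiftedForm mol E (NormedSpace.exp (-clusterAdj t) (CoeffSpace.expand s))
        (NormedSpace.exp (clusterOp t) (CoeffSpace.expand w)) := by
  -- `Ψ₀` is an eigenvector of the transformed Hamiltonian, so the second half of the commutator is
  -- just `E W Ψ₀`.
  have h1 : similarityOp mol t (refDet B h) = (E : ℂ) • refDet B h := by
    change NormedSpace.exp (-clusterOp t) (hamiltonianOp mol
      (NormedSpace.exp (clusterOp t) (refDet B h))) = _
    rw [htΨ, hΨ.hamiltonianOp_apply, map_smul, ← htΨ, exp_neg_exp_apply]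
  rw [fderiv_ccFunction_apply, h1, map_smul, clusterOp_refDet, dualOf_apply, shiftedForm_exp]
  congr 1
  change _ = NormedSpace.exp (-clusterOp t) (shiftedOp mol E
      (NormedSpace.exp (clusterOp t) (CoeffSpace.expand w)))
  rw [shiftedOp, sub_apply, map_sub, smul_apply, one_apply_eq_self, map_smul, exp_neg_exp_apply]
  rfl

theorem norm_fderiv_ccFunction_le (hΨ : IsEigenfunction mol E Ψ)
    (htΨ : NormedSpace.exp (clusterOp t) (refDet B h) = Ψ) :
    ‖fderiv ℂ (ccFunction mol) t‖ ≤ (continuityConst mol E t).toReal := by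
  refine ContinuousLinearMap.opNorm_le_bound _ ENNReal.toReal_nonneg fun w =>
    ContinuousLinearMap.opNorm_le_bound _ (by positivity) fun s => ?_
  have h1 := enorm_shiftedForm_expand_le (mol := mol) (E := E) (t := t) s w
  rw [← fderiv_ccFunction_of_isEigenfunction hΨ htΨ] at h1
  have h2 := ENNReal.toReal_mono (ENNReal.mul_ne_top continuityConst_lt_top.ne
    (ENNReal.mul_ne_top enorm_ne_top enorm_ne_top)) h1
  simp only [toReal_enorm, ENNReal.toReal_mul] at h2
  linarith

theorem IsEigenfunction.overlap_self_ne_zero (hΨ : IsEigenfunction mol E Ψ) :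
    overlap Ψ Ψ ≠ 0 := fun h => hΨ.1 (eq_zero_of_overlap_self h)

theorem overlap_shiftedOp_left (u v : FCISpace N B) :
    overlap (shiftedOp mol E u) v = shiftedForm mol E u v := by
  rw [← conj_overlap, overlap_shiftedOp, conj_shiftedForm]

/-- Nondegeneracy says that `H - E` is injective on the complement of `Ψ`, hence bounded below in
finite dimension. Testing `w` against `v = (H - E) w` gives `‖v‖²` in `L²`, which controls the `H¹`
norm by equivalence of norms. -/
theorem infSupConst_pos (hΨ : IsEigenfunction mol E Ψ) (hE : IsNondegenerate mol B N E) :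
    0 < infSupConst mol E Ψ := by
  set S : Submodule ℂ (FCISpace N B) := LinearMap.ker (overlapRight Ψ) with hS
  have hker : LinearMap.ker (((shiftedOp mol E : FCISpace N B →L[ℂ] FCISpace N B) :
      FCISpace N B →ₗ[ℂ] FCISpace N B).domRestrict S) =
      ⊥ := by
    rw [LinearMap.ker_eq_bot']
    rintro ⟨w, hw⟩ h0
    replace hw : overlap Ψ w = 0 := hw
    replace h0 : shiftedOp mol E w = 0 := h0
    by_contra hne
    have hw0 : w ≠ 0 := fun h => hne (Subtype.ext h)
    have hw1 : IsEigenfunction mol E w := ⟨hw0, fun Φ => by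
      have h1 := overlap_shiftedOp mol E Φ w
      rw [h0, overlap_zero_right, shiftedForm] at h1
      exact (sub_eq_zero.1 h1.symm)⟩
    obtain ⟨c, rfl⟩ := hE Ψ w hΨ hw1
    rw [overlap_smul_right] at hw
    rcases mul_eq_zero.1 hw with hc | hc
    · exact hw0 (by rw [hc, zero_smul])
    · exact hΨ.overlap_self_ne_zero hc
  obtain ⟨k₁, hk₁, ha₁⟩ := LinearMap.exists_antilipschitzWith _
    (FCISpace.toL2_injective (N := N) (B := B))
  obtain ⟨k₂, hk₂, ha₂⟩ := LinearMap.exists_antilipschitzWith _ hker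
  have hb₁ (v : FCISpace N B) : ‖v‖ ≤ k₁ * ‖v.toH1.toL2‖ := by
    simpa using! ha₁.le_mul_dist v 0
  have hb₂ (w : FCISpace N B) (hw : overlap Ψ w = 0) : ‖w‖ ≤ k₂ * ‖shiftedOp mol E w‖ := by
    simpa using! ha₂.le_mul_dist (⟨w, hw⟩ : S) 0
  have hk₁' : (0 : ℝ) < k₁ := hk₁
  have hk₂' : (0 : ℝ) < k₂ := hk₂
  -- Here `k₁` bounds `H¹` by `L²` and enters squared through `‖v‖²`, while `k₂` inverts `H - E` on
  -- the complement.
  set k : ℝ := ((k₁ : ℝ) ^ 2 * k₂)⁻¹ with hk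
  have hk0 : 0 < k := by positivity
  refine (ENNReal.ofReal_pos.2 hk0).trans_le (le_iInf₂ fun w hw => ?_)
  set v := shiftedOp mol E w with hv
  have hv0 : v ≠ 0 := fun h0 => by
    have := hb₂ w hw.1
    rw [← hv, h0, norm_zero, mul_zero] at this
    exact hw.2 (norm_le_zero_iff.1 this)
  have hvΨ : overlap Ψ v = 0 := by
    -- Symmetry of `H - E` moves it onto `Ψ`, which it annihilates, so `v` is an admissible test
    -- vector.
    rw [hv, overlap_shiftedOp, ← overlap_shiftedOp_left, hΨ.shiftedOp_apply, overlap_zero_left]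
  refine le_iSup₂_of_le v ⟨hvΨ, hv0⟩ ?_
  rw [ENNReal.le_div_iff_mul_le (Or.inl (mul_ne_zero (enorm_ne_zero.2 hv0) (enorm_ne_zero.2 hw.2)))
    (Or.inl (ENNReal.mul_ne_top enorm_ne_top enorm_ne_top)), ← overlap_shiftedOp, ← hv,
    overlap_self, ← ofReal_norm, ← ofReal_norm, ← ofReal_norm, ← ENNReal.ofReal_mul (norm_nonneg _),
    ← ENNReal.ofReal_mul hk0.le]
  refine ENNReal.ofReal_le_ofReal ?_
  rw [Complex.norm_real, Real.norm_of_nonneg (by positivity), hk, inv_mul_le_iff₀ (by positivity)]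
  calc ‖v‖ * ‖w‖ ≤ ‖v‖ * (k₂ * ‖v‖) := by gcongr; exact hb₂ w hw.1
    _ = k₂ * ‖v‖ ^ 2 := by ring
    _ ≤ k₂ * (k₁ * ‖v.toH1.toL2‖) ^ 2 := by gcongr; exact hb₁ v
    _ = _ := by ring

theorem projPerp_apply (u : FCISpace N B) :
    projPerp B h u = u - overlap (refDet B h) u • refDet B h := rfl

/-- The inf-sup estimate for the derivative of the coupled cluster function. -/
theorem infSupConst_mul_le (hΨ : IsEigenfunction mol E Ψ)
    (htΨ : NormedSpace.exp (clusterOp t) (refDet B h) = Ψ) (w : CoeffSpace B h) :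
    infSupConst mol E Ψ * ‖w‖ₑ ≤ thetaConst t * ‖fderiv ℂ (ccFunction mol) t w‖ₑ := by
  set W := CoeffSpace.expand w with hW
  set c := overlap Ψ (NormedSpace.exp (clusterOp t) W) / overlap Ψ Ψ with hc
  -- The `L²`-projection of `e^{T} W` onto the complement of `Ψ`.
  set x := NormedSpace.exp (clusterOp t) W - c • Ψ with hx
  have hxΨ : overlap Ψ x = 0 := by
    rw [hx, overlap_sub_right, overlap_smul_right, hc, div_mul_cancel₀ _ hΨ.overlap_self_ne_zero,
      sub_self]
  -- `e^{-T}` sends the subtracted multiple of `Ψ` to a multiple of `Ψ₀`, which `P₀^⊥` removes,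
  -- while `W` is already orthogonal to `Ψ₀`.
  have hWx : ((projPerp B h).comp (NormedSpace.exp (-clusterOp t))) x = W := by
    rw [ContinuousLinearMap.comp_apply, hx, map_sub, map_smul, exp_neg_exp_apply, ← htΨ,
      exp_neg_exp_apply, projPerp_apply, overlap_sub_right, overlap_smul_right,
      overlap_refDet_refDet, hW, overlap_refDet_of_mem (expand_mem_excitedSubspace w)]
    simp
  have hnW : ‖w‖ₑ ≤ ‖(projPerp B h).comp (NormedSpace.exp (-clusterOp t))‖ₑ * ‖x‖ₑ := by
    rw [CoeffSpace.enorm_def, ← hW]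
    nth_rewrite 1 [← hWx]
    exact ContinuousLinearMap.le_opENorm _ _
  -- The infimum defining `γ` excludes `x = 0`, but then `W` vanishes too.
  by_cases hx0 : x = 0
  · rw [hx0, enorm_zero, mul_zero] at hnW
    rw [le_zero_iff.1 hnW, mul_zero]
    exact zero_le
  have hAx : shiftedOp mol E x = shiftedOp mol E (NormedSpace.exp (clusterOp t) W) := by
    rw [hx, map_sub, map_smul, hΨ.shiftedOp_apply, smul_zero, sub_zero]
  have hγ : infSupConst mol E Ψ ≤ ‖fderiv ℂ (ccFunction mol) t w‖ₑ *
      ‖NormedSpace.exp (clusterAdj t)‖ₑ / ‖x‖ₑ := by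
    refine iInf₂_le_of_le x ⟨hxΨ, hx0⟩ (iSup₂_le fun v hv => ?_)
    -- Since `(e^{T†} v, Ψ₀) = (v, e^{T} Ψ₀) = (v, Ψ) = 0`, the vector `e^{T†} v` is excited and has
    -- coefficients `s`.
    obtain ⟨s, hs⟩ : NormedSpace.exp (clusterAdj t) v ∈
        LinearMap.range (CoeffSpace.expand : CoeffSpace B h →ₗ[ℂ] _) := by
      rw [← excitedSubspace_eq_range, mem_excitedSubspace_iff, ← conj_overlap,
        overlap_exp_clusterAdj, htΨ, conj_overlap, hv.1]
    have h1 : shiftedForm mol E v x = fderiv ℂ (ccFunction mol) t w s := by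
      rw [fderiv_ccFunction_of_isEigenfunction hΨ htΨ, hs, exp_neg_exp_apply, ← overlap_shiftedOp,
        hAx, overlap_shiftedOp]
    refine ENNReal.div_le_of_le_mul ?_
    rw [mul_comm ‖v‖ₑ, ← mul_assoc, ENNReal.div_mul_cancel (enorm_ne_zero.2 hx0) enorm_ne_top, h1,
      mul_assoc]
    refine (ContinuousLinearMap.le_opENorm _ s).trans (mul_le_mul_right ?_ _)
    rw [CoeffSpace.enorm_def, hs]
    exact ContinuousLinearMap.le_opENorm _ v
  rw [ENNReal.le_div_iff_mul_le (Or.inl (enorm_ne_zero.2 hx0)) (Or.inl enorm_ne_top)] at hγ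
  calc infSupConst mol E Ψ * ‖w‖ₑ
      ≤ infSupConst mol E Ψ *
        (‖(projPerp B h).comp (NormedSpace.exp (-clusterOp t))‖ₑ * ‖x‖ₑ) := by gcongr
    _ = ‖(projPerp B h).comp (NormedSpace.exp (-clusterOp t))‖ₑ *
        (infSupConst mol E Ψ * ‖x‖ₑ) := by ring
    _ ≤ ‖(projPerp B h).comp (NormedSpace.exp (-clusterOp t))‖ₑ *
        (‖fderiv ℂ (ccFunction mol) t w‖ₑ * ‖NormedSpace.exp (clusterAdj t)‖ₑ) := by gcongr
    _ = _ := by rw [thetaConst]; ring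

theorem ExcIndex.nonempty (hN : 0 < N) (hNK : N < K) : Nonempty (ExcIndex N K) :=
  ⟨⟨({⟨0, hN.trans hNK⟩}, {⟨N, hNK⟩}), by simpa using hN, by simp, by simp, by simp⟩⟩

theorem ExcIndex.isEmpty (hKN : K ≤ N) : IsEmpty (ExcIndex N K) := by
  refine ⟨fun μ => ?_⟩
  obtain ⟨l, hl⟩ : μ.vir.Nonempty := by
    rw [← Finset.card_pos, ← μ.card_eq, Finset.card_pos]; exact μ.2.2.2.1
  exact absurd (μ.2.2.1 l hl) (not_le.2 (l.2.trans_le hKN))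

theorem excDet_ne_zero (μ : ExcIndex N K) : excDet B h μ ≠ 0 :=
  (linearIndependent_excDet B h).ne_zero μ

/-- An infimum over no vectors would be infinite, so a nonzero vector orthogonal to `Ψ` must be
exhibited. An excited determinant minus its component along `Ψ` works: if it vanished, pairing with
`Ψ₀` would kill that component, and the determinant itself would be zero. -/
theorem infSupConst_lt_top (μ : ExcIndex N K) (hΨ : IsEigenfunction mol E Ψ)
    (hnorm : overlap (refDet B h) Ψ = 1) : infSupConst mol E Ψ < ⊤ := by
  set c := overlap Ψ (excDet B h μ) / overlap Ψ Ψ with hc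
  set w := excDet B h μ - c • Ψ with hw
  have hwΨ : overlap Ψ w = 0 := by
    rw [hw, overlap_sub_right, overlap_smul_right, hc, div_mul_cancel₀ _ hΨ.overlap_self_ne_zero,
      sub_self]
  have hw0 : w ≠ 0 := fun h0 => by
    have h1 : overlap (refDet B h) w = -c := by
      rw [hw, overlap_sub_right, overlap_smul_right, hnorm, overlap_refDet_excDet]; ring
    rw [h0, overlap_zero_right, zero_eq_neg] at h1
    rw [hw, h1, zero_smul, sub_zero] at h0
    exact excDet_ne_zero μ h0
  refine lt_of_le_of_lt (iInf₂_le_of_le w ⟨hwΨ, hw0⟩ (iSup₂_le fun v _ => ?_))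
    (enorm_lt_top (x := (shiftedOp mol E : FCISpace N B →L[ℂ] FCISpace N B)))
  refine ENNReal.div_le_of_le_mul ?_
  rw [← overlap_shiftedOp]
  exact enorm_overlap_apply_le _ _ _

theorem thetaConst_lt_top : thetaConst t < ⊤ := ENNReal.mul_lt_top enorm_lt_top enorm_lt_top

theorem thetaConst_pos (μ : ExcIndex N K) : 0 < thetaConst t := by
  refine pos_iff_ne_zero.2 (mul_ne_zero (fun h0 => ?_) fun h0 => ?_)
  · rw [← ofReal_norm, ENNReal.ofReal_eq_zero, norm_le_zero_iff] at h0
    have h1 := exp_neg_exp_apply (clusterAdj t) (excDet B h μ)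
    rw [h0, zero_apply, map_zero] at h1
    exact excDet_ne_zero μ h1.symm
  · rw [← ofReal_norm, ENNReal.ofReal_eq_zero, norm_le_zero_iff] at h0
    have h1 := DFunLike.congr_fun h0 (NormedSpace.exp (clusterOp t) (excDet B h μ))
    rw [ContinuousLinearMap.comp_apply, exp_neg_exp_apply, projPerp_apply, overlap_refDet_excDet,
      zero_smul, sub_zero] at h1
    exact excDet_ne_zero μ h1

/-- If `α` vanished, so would `Df(t)`, contradicting the inf-sup bound. -/
theorem continuityConst_pos (μ : ExcIndex N K) (hΨ : IsEigenfunction mol E Ψ)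
    (hE : IsNondegenerate mol B N E) (htΨ : NormedSpace.exp (clusterOp t) (refDet B h) = Ψ) :
    0 < continuityConst mol E t := by
  refine pos_iff_ne_zero.2 fun h0 => ?_
  have h1 := norm_fderiv_ccFunction_le hΨ htΨ
  rw [h0, ENNReal.toReal_zero, norm_le_zero_iff (a := fderiv ℂ (ccFunction mol) t)] at h1
  have h2 := infSupConst_mul_le hΨ htΨ (CoeffSpace.single μ)
  rw [h1, zero_apply, enorm_zero (E := AntiDual B h), mul_zero, CoeffSpace.enorm_def, CoeffSpace.expand_single] at h2
  exact mul_ne_zero (infSupConst_pos hΨ hE).ne' (enorm_ne_zero.2 (excDet_ne_zero μ))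
    (le_zero_iff.1 h2)

theorem lipschitzFun_lt_top (δ : ℝ) : lipschitzFun mol t δ < ⊤ := by
  obtain ⟨l, hl0, hl⟩ := exists_norm_fderiv_sub_le (contDiff_ccFunction mol) t δ
  refine lt_of_le_of_lt (iSup₂_le fun s hs => ?_) (ENNReal.ofReal_lt_top (r := l))
  refine ENNReal.div_le_of_le_mul ?_
  rw [← ofReal_norm, ← ofReal_norm, ← ENNReal.ofReal_mul hl0]
  exact ENNReal.ofReal_le_ofReal (hl s hs.1)

theorem norm_fderiv_sub_le_lipschitzFun {δ : ℝ} {y : CoeffSpace B h} (hy : y ∈ Metric.ball t δ) :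
    ‖fderiv ℂ (ccFunction mol) y - fderiv ℂ (ccFunction mol) t‖ ≤
      (lipschitzFun mol t δ).toReal * ‖y - t‖ := by
  by_cases hyt : y = t
  · rw [hyt, sub_self (fderiv ℂ (ccFunction mol) t), sub_self t, norm_zero, mul_zero]
    exact (norm_zero (E := CoeffSpace B h →L[ℂ] AntiDual B h)).le
  have h0 : ‖t - y‖ₑ ≠ 0 := enorm_ne_zero.2 (sub_ne_zero.2 (Ne.symm hyt))
  have h1 : ‖fderiv ℂ (ccFunction mol) t - fderiv ℂ (ccFunction mol) y‖ₑ / ‖t - y‖ₑ ≤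
      lipschitzFun mol t δ := le_iSup₂_of_le y ⟨hy, hyt⟩ le_rfl
  rw [ENNReal.div_le_iff h0 enorm_ne_top] at h1
  have h2 := ENNReal.toReal_mono
    (ENNReal.mul_ne_top (lipschitzFun_lt_top δ).ne enorm_ne_top) h1
  rwa [ENNReal.toReal_mul, toReal_enorm, toReal_enorm, norm_sub_rev t y,
    norm_sub_rev (fderiv ℂ (ccFunction mol) t)] at h2

/-- Linear injections in both directions: evaluation on the coefficient vectors of the `Ψ_μ`, and
the `L²` pairing, which is injective by definiteness. -/
theorem finrank_antiDual : Module.finrank ℂ (CoeffSpace B h) = Module.finrank ℂ (AntiDual B h) ∧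
    FiniteDimensional ℂ (AntiDual B h) := by
  let ev : AntiDual B h →ₗ[ℂ] ExcIndex N K → ℂ :=
    { toFun := fun F μ => F (CoeffSpace.single μ)
      map_add' := fun _ _ => rfl
      map_smul' := fun _ _ => rfl }
  have hsum (s : CoeffSpace B h) : s = ∑ μ, CoeffSpace.coord μ s • CoeffSpace.single μ := by
    refine CoeffSpace.expand_injective ?_
    rw [map_sum, CoeffSpace.expand_apply]
    simp only [map_smul, CoeffSpace.expand_single]
  have hev : Function.Injective ev := by
    rw [injective_iff_map_eq_zero]
    intro F hF
    ext s
    rw [hsum s, map_sum]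
    refine Finset.sum_eq_zero fun μ _ => ?_
    rw [map_smulₛₗ, show F (CoeffSpace.single μ) = 0 from congrFun hF μ, smul_zero]
  have hfin : FiniteDimensional ℂ (AntiDual B h) := FiniteDimensional.of_injective ev hev
  refine ⟨le_antisymm ?_ ?_, hfin⟩
  · refine LinearMap.finrank_le_finrank_of_injective
      (f := (dualOf B h : FCISpace N B →ₗ[ℂ] AntiDual B h) ∘ₗ CoeffSpace.expand) ?_
    rw [injective_iff_map_eq_zero]
    intro s hs
    have h1 : dualOf B h (CoeffSpace.expand s) s = 0 := DFunLike.congr_fun hs s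
    rw [dualOf_apply] at h1
    exact CoeffSpace.expand_injective ((eq_zero_of_overlap_self h1).trans (map_zero _).symm)
  · exact LinearMap.finrank_le_finrank_of_injective hev

/-- A point strictly inside the supremum is strictly inside the term of some `δ`. The conditions are
stated multiplicatively, so no case distinction on `L(δ) = 0` remains. -/
theorem exists_of_mem_eball_wellPosedRadius {s : CoeffSpace B h}
    (hγ : infSupConst mol E Ψ < ⊤)
    (hs : s ∈ Metric.eball t (wellPosedRadius mol E Ψ t)) :
    ∃ δ l : ℝ, 0 ≤ l ∧ ‖s - t‖ < δ ∧
      ‖s - t‖ * (l * (thetaConst t).toReal) < (infSupConst mol E Ψ).toReal ∧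
      ‖s - t‖ * l < 2 * (continuityConst mol E t).toReal ∧
      ∀ y ∈ Metric.ball t δ, ‖fderiv ℂ (ccFunction mol) y - fderiv ℂ (ccFunction mol) t‖ ≤
        l * ‖y - t‖ := by
  rw [Metric.mem_eball, wellPosedRadius, lt_iSup_iff] at hs
  obtain ⟨δ, hs⟩ := hs
  rw [lt_iSup_iff] at hs
  obtain ⟨hδ, hs⟩ := hs
  rw [lt_min_iff, lt_min_iff, edist_eq_enorm_sub] at hs
  obtain ⟨h1, h2, h3⟩ := hs
  refine ⟨δ, (lipschitzFun mol t δ).toReal, ENNReal.toReal_nonneg, ?_, ?_, ?_,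
    fun y hy => norm_fderiv_sub_le_lipschitzFun hy⟩
  · have := ENNReal.toReal_strict_mono ENNReal.ofReal_ne_top h1
    rwa [toReal_enorm, ENNReal.toReal_ofReal hδ.le] at this
  · have := ENNReal.toReal_strict_mono hγ.ne (ENNReal.mul_lt_of_lt_div h2)
    rwa [ENNReal.toReal_mul, ENNReal.toReal_mul, toReal_enorm] at this
  · have := ENNReal.toReal_strict_mono
      (ENNReal.mul_ne_top ENNReal.ofNat_ne_top continuityConst_lt_top.ne)
      (ENNReal.mul_lt_of_lt_div h3)
    rwa [ENNReal.toReal_mul, ENNReal.toReal_mul, toReal_enorm, ENNReal.toReal_ofNat] at this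

theorem wellPosedRadius_pos (hγ : 0 < infSupConst mol E Ψ) (hα : 0 < continuityConst mol E t) :
    0 < wellPosedRadius mol E Ψ t := by
  refine lt_of_lt_of_le ?_ (le_iSup₂_of_le (1 : ℝ) one_pos le_rfl)
  refine lt_min (ENNReal.ofReal_pos.2 one_pos) (lt_min ?_ ?_)
  · exact ENNReal.div_pos hγ.ne'
      (ENNReal.mul_ne_top (lipschitzFun_lt_top 1).ne thetaConst_lt_top.ne)
  · exact ENNReal.div_pos (mul_ne_zero two_ne_zero hα.ne') (lipschitzFun_lt_top 1).ne

/-- Without virtual orbitals there are no excitations, and `α`, a supremum over no vectors, is zero.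
-/
theorem wellPosedRadius_eq_zero (hKN : K ≤ N) : wellPosedRadius mol E Ψ t = 0 := by
  have := ExcIndex.isEmpty hKN
  have h1 : continuityConst mol E t = 0 := by
    refine le_zero_iff.1 (iSup₂_le fun Φ hΦ => absurd ?_ hΦ.2)
    have h2 := hΦ.1
    rw [excitedSubspace, Set.range_eq_empty, Submodule.span_empty, Submodule.mem_bot] at h2
    exact h2
  refine le_zero_iff.1 (iSup₂_le fun δ _ => ?_)
  rw [h1, mul_zero, ENNReal.zero_div, min_zero, min_zero]

end

/-! ### The diffeomorphism and the two-sided error estimate. -/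

section

variable {N K : ℕ} {B : SingleParticleBasis K} {h : N ≤ K} {mol : Molecule} {E : ℝ}
  {Ψ : FCISpace N B} {t : CoeffSpace B h}

section
variable (hγ0 : 0 < infSupConst mol E Ψ) (hγ : infSupConst mol E Ψ < ⊤)
  (hΘ0 : 0 < thetaConst t) (hα0 : 0 < continuityConst mol E t)
  (hΨ : IsEigenfunction mol E Ψ) (htΨ : NormedSpace.exp (clusterOp t) (refDet B h) = Ψ)
include hγ hΘ0 hΨ htΨ

theorem div_mul_norm_le_norm_fderiv (w : CoeffSpace B h) :
    (infSupConst mol E Ψ).toReal / (thetaConst t).toReal * ‖w‖ ≤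
      ‖fderiv ℂ (ccFunction mol) t w‖ := by
  have hθ : 0 < (thetaConst t).toReal := ENNReal.toReal_pos hΘ0.ne' thetaConst_lt_top.ne
  have h1 := ENNReal.toReal_mono (ENNReal.mul_ne_top thetaConst_lt_top.ne enorm_ne_top)
    (infSupConst_mul_le hΨ htΨ w)
  rw [ENNReal.toReal_mul, ENNReal.toReal_mul, toReal_enorm, toReal_enorm] at h1
  rw [div_mul_eq_mul_div, div_le_iff₀ hθ]
  linarith

theorem isOpen_image_and_isDiffeoOn_ccFunction :
    IsOpen (ccFunction mol '' Metric.eball t (wellPosedRadius mol E Ψ t)) ∧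
      IsDiffeoOn (ccFunction mol) (Metric.eball t (wellPosedRadius mol E Ψ t)) := by
  obtain ⟨hdim, hfin⟩ := finrank_antiDual (B := B) (h := h)
  have hθ : 0 < (thetaConst t).toReal := ENNReal.toReal_pos hΘ0.ne' thetaConst_lt_top.ne
  have key {s s' : CoeffSpace B h} (hs : s ∈ Metric.eball t (wellPosedRadius mol E Ψ t))
      (hs' : ‖s' - t‖ ≤ ‖s - t‖) : ∃ δ l r : ℝ, 0 ≤ l ∧ r < δ ∧
        l * r < (infSupConst mol E Ψ).toReal / (thetaConst t).toReal ∧ ‖s - t‖ ≤ r ∧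
        ‖s' - t‖ ≤ r ∧ ∀ y ∈ Metric.ball t δ,
          ‖fderiv ℂ (ccFunction mol) y - fderiv ℂ (ccFunction mol) t‖ ≤ l * ‖y - t‖ := by
    obtain ⟨δ, l, hl0, h1, h2, -, h4⟩ := exists_of_mem_eball_wellPosedRadius hγ hs
    refine ⟨δ, l, ‖s - t‖, hl0, h1, ?_, le_rfl, hs', h4⟩
    rw [lt_div_iff₀ hθ]
    linarith
  refine isOpen_image_and_isDiffeoOn hdim (contDiff_ccFunction mol) (x₀ := t)
    (div_mul_norm_le_norm_fderiv hγ hΘ0 hΨ htΨ) Metric.isOpen_eball fun s hs s' hs' => ?_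
  -- The data of the point farther from `t` serve for both.
  rcases le_total ‖s' - t‖ ‖s - t‖ with hle | hle
  · exact key hs hle
  · obtain ⟨δ, l, r, h1, h2, h3, h4, h5, h6⟩ := key hs' hle
    exact ⟨δ, l, r, h1, h2, h3, h5, h4, h6⟩

include hγ0 hα0

/-- Since `f(t) = 0`, `f(s)` equals `Df(t)(s - t)` up to the quadratic remainder, and the choice of
`R` absorbs that remainder on either side. -/
theorem ccFunction_bounds (ht : ccFunction mol t = 0) {s : CoeffSpace B h}
    (hs : s ∈ Metric.eball t (wellPosedRadius mol E Ψ t)) :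
    1 / 2 * (1 / continuityConst mol E t) * ‖ccFunction mol s‖ₑ ≤ ‖t - s‖ₑ ∧
      ‖t - s‖ₑ ≤ 2 * (thetaConst t / infSupConst mol E Ψ) * ‖ccFunction mol s‖ₑ := by
  have hθ : 0 < (thetaConst t).toReal := ENNReal.toReal_pos hΘ0.ne' thetaConst_lt_top.ne
  have hg : 0 < (infSupConst mol E Ψ).toReal := ENNReal.toReal_pos hγ0.ne' hγ.ne
  have ha : 0 < (continuityConst mol E t).toReal :=
    ENNReal.toReal_pos hα0.ne' continuityConst_lt_top.ne
  obtain ⟨δ, l, hl0, h1, h2, h3, h4⟩ := exists_of_mem_eball_wellPosedRadius hγ hs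
  have hr := norm_nonneg (s - t)
  have h5 := norm_sub_sub_fderiv_le
    ((contDiff_ccFunction (B := B) (h := h) mol).differentiable (by simp)) h4
    (mem_ball_iff_norm.2 h1)
  rw [ht, sub_zero] at h5
  have h6 := div_mul_norm_le_norm_fderiv hγ hΘ0 hΨ htΨ (s - t)
  have h7 := ContinuousLinearMap.le_of_opNorm_le _ (norm_fderiv_ccFunction_le hΨ htΨ) (s - t)
  have h8 := norm_sub_norm_le (ccFunction mol s) (fderiv ℂ (ccFunction mol) t (s - t))
  have h9 := norm_sub_norm_le (fderiv ℂ (ccFunction mol) t (s - t)) (ccFunction mol s)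
  rw [norm_sub_rev] at h9
  rw [div_mul_eq_mul_div, div_le_iff₀ hθ] at h6
  set r := ‖s - t‖
  set g := (infSupConst mol E Ψ).toReal
  set θ := (thetaConst t).toReal
  set a := (continuityConst mol E t).toReal
  set F := ‖ccFunction mol s‖ with hF
  have hfin1 : 1 / 2 * (1 / continuityConst mol E t) * ‖ccFunction mol s‖ₑ ≠ ⊤ :=
    ENNReal.mul_ne_top (ENNReal.mul_ne_top (by simp) (ENNReal.div_ne_top ENNReal.one_ne_top hα0.ne'))
      enorm_ne_top
  have hfin2 : 2 * (thetaConst t / infSupConst mol E Ψ) * ‖ccFunction mol s‖ₑ ≠ ⊤ :=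
    ENNReal.mul_ne_top (ENNReal.mul_ne_top ENNReal.ofNat_ne_top
      (ENNReal.div_ne_top thetaConst_lt_top.ne hγ0.ne')) enorm_ne_top
  have hts : ‖t - s‖ = r := norm_sub_rev _ _
  constructor
  · rw [← ENNReal.toReal_le_toReal hfin1 enorm_ne_top]
    simp only [ENNReal.toReal_mul, ENNReal.toReal_div, toReal_enorm, ENNReal.toReal_one,
      ENNReal.toReal_ofNat, hts]
    -- From `r l < 2 a` the remainder `l r² / 2` is at most `a r`.
    have h10 : F ≤ 2 * a * r := by nlinarith
    calc 1 / 2 * (1 / a) * F ≤ 1 / 2 * (1 / a) * (2 * a * r) := by gcongr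
      _ = r := by field_simp
  · rw [← ENNReal.toReal_le_toReal enorm_ne_top hfin2]
    simp only [ENNReal.toReal_mul, ENNReal.toReal_div, toReal_enorm, ENNReal.toReal_ofNat, hts]
    -- From `r l θ < g` the remainder, multiplied by `θ`, is at most `r g / 2`, half of the left
    -- side.
    have h10 : r * g ≤ 2 * θ * F := by
      have h11 : r * (r * (l * θ)) ≤ r * g := mul_le_mul_of_nonneg_left h2.le hr
      nlinarith
    calc r = r * g / g := by field_simp
      _ ≤ 2 * θ * F / g := by gcongr
      _ = 2 * (θ / g) * F := by ring

end

end

end CoupledCluster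

end

theorem mainTheorem7 {N K : ℕ} (hN : 0 < N) (hNK : N ≤ K) (mol : Molecule)
    (B : SingleParticleBasis K) (E : ℝ) (Ψ : FCISpace N B)
    (hΨ : IsEigenfunction mol E Ψ) (hE : IsNondegenerate mol B N E)
    (hnorm : overlap (refDet B hNK) Ψ = 1)
    (t : CoeffSpace B hNK) (ht : ccFunction mol t = 0)
    (htΨ : NormedSpace.exp (clusterOp t) (refDet B hNK) = Ψ) :
    (N < K →
      (0 < infSupConst mol E Ψ ∧ infSupConst mol E Ψ < ⊤) ∧
      (0 < thetaConst t ∧ thetaConst t < ⊤) ∧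
      (0 < continuityConst mol E t ∧ continuityConst mol E t < ⊤) ∧
      (∀ δ : ℝ, 0 < δ → lipschitzFun mol t δ < ⊤) ∧
      0 < wellPosedRadius mol E Ψ t) ∧
    IsOpen (ccFunction mol '' Metric.eball t (wellPosedRadius mol E Ψ t)) ∧
    IsDiffeoOn (ccFunction mol) (Metric.eball t (wellPosedRadius mol E Ψ t)) ∧
    (∀ s ∈ Metric.eball t (wellPosedRadius mol E Ψ t),
      1 / 2 * (1 / continuityConst mol E t) * ‖ccFunction mol s‖ₑ ≤ ‖t - s‖ₑ ∧
      ‖t - s‖ₑ ≤ 2 * (thetaConst t / infSupConst mol E Ψ) * ‖ccFunction mol s‖ₑ) ∧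
    ∀ s ∈ Metric.eball t (wellPosedRadius mol E Ψ t), ccFunction mol s = 0 → s = t := by
  rcases hNK.lt_or_eq with hlt | heq
  · obtain ⟨μ⟩ := ExcIndex.nonempty hN hlt
    have hγ0 := infSupConst_pos hΨ hE
    have hγ := infSupConst_lt_top μ hΨ hnorm
    have hΘ0 : 0 < thetaConst t := thetaConst_pos μ
    have hα0 := continuityConst_pos μ hΨ hE htΨ
    obtain ⟨h1, h2⟩ := isOpen_image_and_isDiffeoOn_ccFunction hγ hΘ0 hΨ htΨ
    have h3 (s) (hs : s ∈ Metric.eball t (wellPosedRadius mol E Ψ t)) :=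
      ccFunction_bounds hγ0 hγ hΘ0 hα0 hΨ htΨ ht hs
    refine ⟨fun _ => ⟨⟨hγ0, hγ⟩, ⟨hΘ0, thetaConst_lt_top⟩, ⟨hα0, continuityConst_lt_top⟩,
      fun δ _ => lipschitzFun_lt_top δ, wellPosedRadius_pos hγ0 hα0⟩, h1, h2, h3,
      fun s hs hs0 => ?_⟩
    have h4 := (h3 s hs).2
    rw [hs0, enorm_zero (E := AntiDual B hNK), mul_zero, le_zero_iff, enorm_eq_zero,
      sub_eq_zero] at h4
    exact h4.symm
  -- For `K = N` the radius is zero, the ball is empty and every claim is vacuous.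
  · have hR : Metric.eball t (wellPosedRadius mol E Ψ t) = ∅ := by
      rw [wellPosedRadius_eq_zero heq.ge, Metric.eball_zero]
    rw [hR]
    refine ⟨fun hlt => absurd heq hlt.ne, by simp, ?_, by simp, by simp⟩
    exact ⟨contDiffOn_empty, Set.injOn_empty _, fun _ => t, by simp, by simp [contDiffOn_empty]⟩
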